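/- Let $\mathbb F_2^n$ be the space of vectors $x=(x_0,\dots,x_{n-1})$ over $\mathbb F_2$. A Boolean function $f\colon\mathbb F_2^n\to\mathbb F_2$ is uniquely a polynomial over $\mathbb F_2$ in square-free monomials (its algebraic normal form); it is *homogeneous cubic* if it is nonzero and all monomials of its algebraic normal form have degree $3$. It is *bent* if for all $a\in\mathbb F_2^n\setminus\{0\}$ and $b\in\mathbb F_2$ the equation $f(x+a)+f(x)=b$ has exactly $2^{n-1}$ solutions $x\in\mathbb F_2^n$. Two functions $f,f'$ on $\mathbb F_2^n$ are *equivalent* if there are an invertible affine transformation $A$ of $\mathbb F_2^n$, a vector $a\in\mathbb F_2^n$ and $b\in\mathbb F_2$ with $f'(x)=f(Ax)+\langle a,x\rangle+b$ for all $x$. For $n=2m$, the Maiorana--McFarland class $\mathcal M$ consists of the functions $(x,y)\mapsto\langle x,\pi(y)\rangle+\phi(y)$ on $\mathbb F_2^m\times\mathbb F_2^m$, where $\pi$ is a permutation of $\mathbb F_2^m$ and $\phi\colon\mathbb F_2^m\to\mathbb F_2$ is arbitrary; the completed class $\mathcal M^{\#}$ consists of all functions equivalent to a member of $\mathcal M$.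 Let $h^{10}_1,\dots,h^{10}_4$ and $h^{12}_1,\dots,h^{12}_5$ be the following functions in $10$ and $12$ variables, which represent the equivalence classes of the homogeneous cubic bent functions found by Charnes--Rötteler--Beth and Meng et al. Each is given as the sum of the listed monomials, where $ijk$ stands for $x_ix_jx_k$ and the digits $a,b$ stand for the indices $10,11$. - $h^{10}_{1}$: 015, 017, 018, 019, 023, 026, 027, 028, 034, 038, 039, 046, 048, 049, 067, 068, 125, 126, 128, 129, 159, 168, 178, 179, 189, 236, 239, 245, 246, 247, 248, 256, 258, 259, 269, 279, 345, 346, 356, 357, 359, 367, 378, 379, 389, 457, 459, 467, 468, 479, 589, 678, 679 - $h^{10}_{2}$: 012, 013, 014, 015, 016, 017, 018, 019, 023, 024, 025, 029, 036, 037, 038, 045, 048, 049, 056, 059, 067, 068, 078, 079, 123, 126, 127, 128, 134, 135, 139, 145, 148, 149, 156, 159, 167, 168, 178, 179, 234, 235, 236, 237, 238, 239, 245, 248, 249, 256, 259, 267, 268, 278, 279, 345, 348, 349, 356, 359, 367, 368, 378, 379, 456, 478, 489, 568, 579, 679 - $h^{10}_{3}$: 012, 015, 017, 019, 024, 025, 028,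 029, 034, 039, 046, 049, 058, 067, 078, 089, 125, 126, 128, 129, 159, 168, 178, 179, 189, 236, 239, 245, 246, 247, 248, 256, 258, 259, 269, 279, 345, 346, 356, 357, 359, 367, 378, 379, 389, 457, 459, 467, 468, 479, 589, 678, 679 - $h^{10}_{4}$: 015, 016, 017, 019, 023, 024, 026, 028, 029, 034, 035, 037, 038, 039, 046, 056, 057, 059, 068, 069, 089, 124, 127, 128, 129, 135, 136, 137, 145, 148, 156, 158, 159, 167, 169, 178, 179, 189, 236, 238, 245, 246, 247, 249, 257, 258, 269, 278, 279, 289, 346, 348, 349, 357, 359, 367, 368, 369, 379, 389, 457, 458, 459, 468, 469, 478, 479, 489, 567, 579, 589, 679 - $h^{12}_{1}$: 024, 027, 02a, 02b, 034, 038, 046, 049, 056, 05a, 068, 06b, 078, 08a, 09a, 123, 127, 135, 138, 13b, 145, 149, 157, 15a, 167, 16b, 179, 189, 19b, 1ab, 235, 236, 237, 24b, 25b, 26b, 278, 289, 29a, 346, 347, 348, 389, 39a, 3ab, 457, 458, 459, 49a, 4ab, 568, 569, 56a, 5ab, 679, 67a, 67b, 78a, 78b, 89b - $h^{12}_{2}$: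 024, 025, 027, 029, 02a, 02b, 034, 036, 038, 03a, 046, 047, 049, 04b, 056, 058, 05a, 068, 069, 06b, 078, 07a, 08a, 08b, 09a, 123, 125, 127, 129, 135, 136, 138, 13a, 13b, 145, 147, 149, 14b, 157, 158, 15a, 167, 169, 16b, 179, 17a, 189, 18b, 19b, 1ab, 237, 239, 23a, 245, 247, 249, 256, 257, 25a, 26b, 278, 279, 27a, 28b, 29b, 348, 34a, 34b, 356, 358, 35a, 367, 368, 36b, 389, 38a, 38b, 459, 45b, 467, 469, 46b, 478, 479, 49a, 49b, 56a, 578, 57a, 589, 58a, 5ab, 67b, 689, 68b, 69a, 69b, 79a, 7ab, 8ab - $h^{12}_{3}$: 023, 024, 026, 027, 028, 02a, 035, 038, 03b, 045, 046, 048, 049, 04a, 057, 05a, 067, 068, 06a, 06b, 079, 089, 08a, 09b, 0ab, 124, 127, 12a, 12b, 134, 135, 137, 138, 139, 13b, 146, 149, 156, 157, 159, 15a, 15b, 168, 16b, 178, 179, 17b, 18a, 19a, 19b, 234, 235, 237, 239, 23b, 246, 24a, 24b, 256, 26b, 278, 28a, 28b, 29a, 2ab, 345, 346, 348, 34a, 357,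 35b, 367, 389, 39b, 3ab, 456, 457, 459, 45b, 468, 478, 49a, 567, 568, 56a, 579, 589, 5ab, 678, 679, 67b, 68a, 69a, 789, 78a, 79b, 7ab, 89a, 89b, 9ab - $h^{12}_{4}$: 023, 025, 026, 027, 028, 029, 036, 038, 03a, 045, 047, 048, 049, 04a, 04b, 058, 05a, 067, 069, 06a, 06b, 07a, 089, 08b, 0ab, 125, 127, 129, 12b, 134, 136, 137, 138, 139, 13a, 147, 149, 14b, 156, 158, 159, 15a, 15b, 169, 16b, 178, 17a, 17b, 18b, 19a, 234, 235, 237, 239, 23b, 246, 24a, 24b, 256, 26b, 278, 28a, 28b, 29a, 2ab, 345, 346, 348, 34a, 357, 35b, 367, 389, 39b, 3ab, 456, 457, 459, 45b, 468, 478, 49a, 567, 568, 56a, 579, 589, 5ab, 678, 679, 67b, 68a, 69a, 789, 78a, 79b, 7ab, 89a, 89b, 9ab - $h^{12}_{5}$: 024, 025, 027, 02a, 038, 03a, 046, 047, 049, 05a, 068, 069, 06b, 08a, 08b, 127, 129, 135, 136, 138, 13b, 149, 14b, 157, 158, 15a, 16b, 179, 17a, 19b, 234, 235, 239, 23a, 23b,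 245, 247, 249, 24b, 256, 257, 25a, 279, 27a, 28b, 29a, 29b, 2ab, 345, 346, 34a, 34b, 356, 358, 35a, 367, 368, 36b, 38a, 38b, 3ab, 456, 457, 45b, 467, 469, 46b, 478, 479, 49b, 567, 568, 578, 57a, 589, 58a, 678, 679, 689, 68b, 69a, 69b, 789, 78a, 79a, 7ab, 89a, 89b, 8ab, 9ab **Theorem.** All these functions are homogeneous cubic bent functions. Moreover: 1. The functions $h^{10}_1,\dots,h^{10}_4$ lie in exactly $4$ distinct equivalence classes. The classes of $h^{10}_3$ and $h^{10}_4$ are disjoint from $\mathcal M^{\#}$, and the classes of $h^{10}_1$ and $h^{10}_2$ are contained in $\mathcal M^{\#}$. 2. The functions $h^{12}_1,\dots,h^{12}_5$ lie in exactly $5$ distinct equivalence classes, all of which are contained in $\mathcal M^{\#}$. -/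

import Mathlib

namespace CubicBent

/-- Boolean functions in `n` variables, i.e. maps `𝔽₂ⁿ → 𝔽₂`. -/
abbrev BoolFun (n : ℕ) : Type := (Fin n → ZMod 2) → ZMod 2

/-- The first-order derivative of `f` in the direction `a`. -/
def derivative {n : ℕ} (a : Fin n → ZMod 2) (f : BoolFun n) : BoolFun n :=
  fun x => f (x + a) + f x

/-- `f` is bent: every equation `D_a f (x) = b` with `a ≠ 0` has exactly `2 ^ (n - 1)` solutions. -/
def IsBent {n : ℕ} (f : BoolFun n) : Prop :=
  ∀ a : Fin n → ZMod 2, a ≠ 0 → ∀ b : ZMod 2,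
    {x : Fin n → ZMod 2 | derivative a f x = b}.ncard = 2 ^ (n - 1)

/-- `c` is the coefficient family of the algebraic normal form of `f`; a square-free monomial is
given by the set of its variables. Each Boolean function has exactly one such family. -/
def IsANF {n : ℕ} (f : BoolFun n) (c : Finset (Fin n) → ZMod 2) : Prop :=
  ∀ x : Fin n → ZMod 2, f x = ∑ v : Finset (Fin n), c v * ∏ i ∈ v, x i

/-- All monomials in the algebraic normal form of `f` have degree `d`. -/
def IsHomogeneous {n : ℕ} (d : ℕ) (f : BoolFun n) : Prop :=
  ∃ c : Finset (Fin n) → ZMod 2, IsANF f c ∧ ∀ v, c v ≠ 0 → v.card = d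

/-- The algebraic degree of `f` is `d` (`f` not the zero function). -/
def HasDegree {n : ℕ} (d : ℕ) (f : BoolFun n) : Prop :=
  ∃ c : Finset (Fin n) → ZMod 2, IsANF f c ∧ (∀ v, c v ≠ 0 → v.card ≤ d) ∧
    ∃ v, c v ≠ 0 ∧ v.card = d

/-- `f` is a homogeneous cubic bent function. -/
def IsHomogeneousCubicBent {n : ℕ} (f : BoolFun n) : Prop :=
  HasDegree 3 f ∧ IsHomogeneous 3 f ∧ IsBent f

/-- `f` and `f'` are equivalent: `f' x = f (A x) + ⟨a, x⟩ + b` for an invertible affine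
transformation `A` of `𝔽₂ⁿ`, a vector `a` and a constant `b`. -/
def Equivalent {n : ℕ} (f f' : BoolFun n) : Prop :=
  ∃ (A : (Fin n → ZMod 2) ≃ᵃ[ZMod 2] (Fin n → ZMod 2)) (a : Fin n → ZMod 2) (b : ZMod 2),
    ∀ x, f' x = f (A x) + (a ⬝ᵥ x + b)

/-- The equivalence class of `f`. -/
def equivClass {n : ℕ} (f : BoolFun n) : Set (BoolFun n) :=
  {g | Equivalent f g}

/-- The Maiorana-McFarland class `ℳ` of bent functions in `2m` variables: the functions
`(x, y) ↦ ⟨x, π y⟩ + φ y` with `π` a permutation of `𝔽₂ᵐ` and `φ` a Boolean function. -/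
def maioranaMcFarland (m : ℕ) : Set (BoolFun (m + m)) :=
  {f | ∃ (π : Equiv.Perm (Fin m → ZMod 2)) (φ : BoolFun m),
    ∀ x y : Fin m → ZMod 2, f (Fin.append x y) = x ⬝ᵥ π y + φ y}

/-- The completed Maiorana-McFarland class `ℳ^#` in `2m` variables. -/
def completedMM (m : ℕ) : Set (BoolFun (m + m)) :=
  {f | ∃ g ∈ maioranaMcFarland m, Equivalent g f}

/-- The sum over `𝔽₂` of the monomials `x_i x_j x_k`, `(i, j, k)` running through a list. -/
def cubicForm {n : ℕ} (l : List (Fin n × Fin n × Fin n)) : BoolFun n :=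
  fun x => (l.map fun t => x t.1 * x t.2.1 * x t.2.2).sum

def h10_1 : BoolFun 10 := cubicForm [
  (0,1,5), (0,1,7), (0,1,8), (0,1,9), (0,2,3), (0,2,6), (0,2,7), (0,2,8), (0,3,4), (0,3,8),
  (0,3,9), (0,4,6), (0,4,8), (0,4,9), (0,6,7), (0,6,8), (1,2,5), (1,2,6), (1,2,8), (1,2,9),
  (1,5,9), (1,6,8), (1,7,8), (1,7,9), (1,8,9), (2,3,6), (2,3,9), (2,4,5), (2,4,6), (2,4,7),
  (2,4,8), (2,5,6), (2,5,8), (2,5,9), (2,6,9), (2,7,9), (3,4,5), (3,4,6), (3,5,6), (3,5,7),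
  (3,5,9), (3,6,7), (3,7,8), (3,7,9), (3,8,9), (4,5,7), (4,5,9), (4,6,7), (4,6,8), (4,7,9),
  (5,8,9), (6,7,8), (6,7,9)]

def h10_2 : BoolFun 10 := cubicForm [
  (0,1,2), (0,1,3), (0,1,4), (0,1,5), (0,1,6), (0,1,7), (0,1,8), (0,1,9), (0,2,3), (0,2,4),
  (0,2,5), (0,2,9), (0,3,6), (0,3,7), (0,3,8), (0,4,5), (0,4,8), (0,4,9), (0,5,6), (0,5,9),
  (0,6,7), (0,6,8), (0,7,8), (0,7,9), (1,2,3), (1,2,6), (1,2,7), (1,2,8), (1,3,4), (1,3,5),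
  (1,3,9), (1,4,5), (1,4,8), (1,4,9), (1,5,6), (1,5,9), (1,6,7), (1,6,8), (1,7,8), (1,7,9),
  (2,3,4), (2,3,5), (2,3,6), (2,3,7), (2,3,8), (2,3,9), (2,4,5), (2,4,8), (2,4,9), (2,5,6),
  (2,5,9), (2,6,7), (2,6,8), (2,7,8), (2,7,9), (3,4,5), (3,4,8), (3,4,9), (3,5,6), (3,5,9),
  (3,6,7), (3,6,8), (3,7,8), (3,7,9), (4,5,6), (4,7,8), (4,8,9), (5,6,8), (5,7,9), (6,7,9)]

def h10_3 : BoolFun 10 := cubicForm [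
  (0,1,2), (0,1,5), (0,1,7), (0,1,9), (0,2,4), (0,2,5), (0,2,8), (0,2,9), (0,3,4), (0,3,9),
  (0,4,6), (0,4,9), (0,5,8), (0,6,7), (0,7,8), (0,8,9), (1,2,5), (1,2,6), (1,2,8), (1,2,9),
  (1,5,9), (1,6,8), (1,7,8), (1,7,9), (1,8,9), (2,3,6), (2,3,9), (2,4,5), (2,4,6), (2,4,7),
  (2,4,8), (2,5,6), (2,5,8), (2,5,9), (2,6,9), (2,7,9), (3,4,5), (3,4,6), (3,5,6), (3,5,7),
  (3,5,9), (3,6,7), (3,7,8), (3,7,9), (3,8,9), (4,5,7), (4,5,9), (4,6,7), (4,6,8), (4,7,9),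
  (5,8,9), (6,7,8), (6,7,9)]

def h10_4 : BoolFun 10 := cubicForm [
  (0,1,5), (0,1,6), (0,1,7), (0,1,9), (0,2,3), (0,2,4), (0,2,6), (0,2,8), (0,2,9), (0,3,4),
  (0,3,5), (0,3,7), (0,3,8), (0,3,9), (0,4,6), (0,5,6), (0,5,7), (0,5,9), (0,6,8), (0,6,9),
  (0,8,9), (1,2,4), (1,2,7), (1,2,8), (1,2,9), (1,3,5), (1,3,6), (1,3,7), (1,4,5), (1,4,8),
  (1,5,6), (1,5,8), (1,5,9), (1,6,7), (1,6,9), (1,7,8), (1,7,9), (1,8,9), (2,3,6), (2,3,8),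
  (2,4,5), (2,4,6), (2,4,7), (2,4,9), (2,5,7), (2,5,8), (2,6,9), (2,7,8), (2,7,9), (2,8,9),
  (3,4,6), (3,4,8), (3,4,9), (3,5,7), (3,5,9), (3,6,7), (3,6,8), (3,6,9), (3,7,9), (3,8,9),
  (4,5,7), (4,5,8), (4,5,9), (4,6,8), (4,6,9), (4,7,8), (4,7,9), (4,8,9), (5,6,7), (5,7,9),
  (5,8,9), (6,7,9)]

/-- The listed homogeneous cubic bent functions in 10 variables. -/
def known10 : Set (BoolFun 10) := {h10_1, h10_2, h10_3, h10_4}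

def h12_1 : BoolFun 12 := cubicForm [
  (0,2,4), (0,2,7), (0,2,10), (0,2,11), (0,3,4), (0,3,8), (0,4,6), (0,4,9), (0,5,6), (0,5,10),
  (0,6,8), (0,6,11), (0,7,8), (0,8,10), (0,9,10), (1,2,3), (1,2,7), (1,3,5), (1,3,8), (1,3,11),
  (1,4,5), (1,4,9), (1,5,7), (1,5,10), (1,6,7), (1,6,11), (1,7,9), (1,8,9), (1,9,11), (1,10,11),
  (2,3,5), (2,3,6), (2,3,7), (2,4,11), (2,5,11), (2,6,11), (2,7,8), (2,8,9), (2,9,10), (3,4,6),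
  (3,4,7), (3,4,8), (3,8,9), (3,9,10), (3,10,11), (4,5,7), (4,5,8), (4,5,9), (4,9,10),
  (4,10,11), (5,6,8), (5,6,9), (5,6,10), (5,10,11), (6,7,9), (6,7,10), (6,7,11), (7,8,10),
  (7,8,11), (8,9,11)]

def h12_2 : BoolFun 12 := cubicForm [
  (0,2,4), (0,2,5), (0,2,7), (0,2,9), (0,2,10), (0,2,11), (0,3,4), (0,3,6), (0,3,8), (0,3,10),
  (0,4,6), (0,4,7), (0,4,9), (0,4,11), (0,5,6), (0,5,8), (0,5,10), (0,6,8), (0,6,9), (0,6,11),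
  (0,7,8), (0,7,10), (0,8,10), (0,8,11), (0,9,10), (1,2,3), (1,2,5), (1,2,7), (1,2,9), (1,3,5),
  (1,3,6), (1,3,8), (1,3,10), (1,3,11), (1,4,5), (1,4,7), (1,4,9), (1,4,11), (1,5,7), (1,5,8),
  (1,5,10), (1,6,7), (1,6,9), (1,6,11), (1,7,9), (1,7,10), (1,8,9), (1,8,11), (1,9,11),
  (1,10,11), (2,3,7), (2,3,9), (2,3,10), (2,4,5), (2,4,7), (2,4,9), (2,5,6), (2,5,7), (2,5,10),
  (2,6,11), (2,7,8), (2,7,9), (2,7,10), (2,8,11), (2,9,11), (3,4,8), (3,4,10), (3,4,11),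
  (3,5,6), (3,5,8), (3,5,10), (3,6,7), (3,6,8), (3,6,11), (3,8,9), (3,8,10), (3,8,11), (4,5,9),
  (4,5,11), (4,6,7), (4,6,9), (4,6,11), (4,7,8), (4,7,9), (4,9,10), (4,9,11), (5,6,10), (5,7,8),
  (5,7,10), (5,8,9), (5,8,10), (5,10,11), (6,7,11), (6,8,9), (6,8,11), (6,9,10), (6,9,11),
  (7,9,10), (7,10,11), (8,10,11)]

def h12_3 : BoolFun 12 := cubicForm [
  (0,2,3), (0,2,4), (0,2,6), (0,2,7), (0,2,8), (0,2,10), (0,3,5), (0,3,8), (0,3,11), (0,4,5),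
  (0,4,6), (0,4,8), (0,4,9), (0,4,10), (0,5,7), (0,5,10), (0,6,7), (0,6,8), (0,6,10), (0,6,11),
  (0,7,9), (0,8,9), (0,8,10), (0,9,11), (0,10,11), (1,2,4), (1,2,7), (1,2,10), (1,2,11),
  (1,3,4), (1,3,5), (1,3,7), (1,3,8), (1,3,9), (1,3,11), (1,4,6), (1,4,9), (1,5,6), (1,5,7),
  (1,5,9), (1,5,10), (1,5,11), (1,6,8), (1,6,11), (1,7,8), (1,7,9), (1,7,11), (1,8,10),
  (1,9,10), (1,9,11), (2,3,4), (2,3,5), (2,3,7), (2,3,9), (2,3,11), (2,4,6), (2,4,10), (2,4,11),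
  (2,5,6), (2,6,11), (2,7,8), (2,8,10), (2,8,11), (2,9,10), (2,10,11), (3,4,5), (3,4,6),
  (3,4,8), (3,4,10), (3,5,7), (3,5,11), (3,6,7), (3,8,9), (3,9,11), (3,10,11), (4,5,6), (4,5,7),
  (4,5,9), (4,5,11), (4,6,8), (4,7,8), (4,9,10), (5,6,7), (5,6,8), (5,6,10), (5,7,9), (5,8,9),
  (5,10,11), (6,7,8), (6,7,9), (6,7,11), (6,8,10), (6,9,10), (7,8,9), (7,8,10), (7,9,11),
  (7,10,11), (8,9,10), (8,9,11), (9,10,11)]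

def h12_4 : BoolFun 12 := cubicForm [
  (0,2,3), (0,2,5), (0,2,6), (0,2,7), (0,2,8), (0,2,9), (0,3,6), (0,3,8), (0,3,10), (0,4,5),
  (0,4,7), (0,4,8), (0,4,9), (0,4,10), (0,4,11), (0,5,8), (0,5,10), (0,6,7), (0,6,9), (0,6,10),
  (0,6,11), (0,7,10), (0,8,9), (0,8,11), (0,10,11), (1,2,5), (1,2,7), (1,2,9), (1,2,11),
  (1,3,4), (1,3,6), (1,3,7), (1,3,8), (1,3,9), (1,3,10), (1,4,7), (1,4,9), (1,4,11), (1,5,6),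
  (1,5,8), (1,5,9), (1,5,10), (1,5,11), (1,6,9), (1,6,11), (1,7,8), (1,7,10), (1,7,11),
  (1,8,11), (1,9,10), (2,3,4), (2,3,5), (2,3,7), (2,3,9), (2,3,11), (2,4,6), (2,4,10), (2,4,11),
  (2,5,6), (2,6,11), (2,7,8), (2,8,10), (2,8,11), (2,9,10), (2,10,11), (3,4,5), (3,4,6),
  (3,4,8), (3,4,10), (3,5,7), (3,5,11), (3,6,7), (3,8,9), (3,9,11), (3,10,11), (4,5,6), (4,5,7),
  (4,5,9), (4,5,11), (4,6,8), (4,7,8), (4,9,10), (5,6,7), (5,6,8), (5,6,10), (5,7,9), (5,8,9),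
  (5,10,11), (6,7,8), (6,7,9), (6,7,11), (6,8,10), (6,9,10), (7,8,9), (7,8,10), (7,9,11),
  (7,10,11), (8,9,10), (8,9,11), (9,10,11)]

def h12_5 : BoolFun 12 := cubicForm [
  (0,2,4), (0,2,5), (0,2,7), (0,2,10), (0,3,8), (0,3,10), (0,4,6), (0,4,7), (0,4,9), (0,5,10),
  (0,6,8), (0,6,9), (0,6,11), (0,8,10), (0,8,11), (1,2,7), (1,2,9), (1,3,5), (1,3,6), (1,3,8),
  (1,3,11), (1,4,9), (1,4,11), (1,5,7), (1,5,8), (1,5,10), (1,6,11), (1,7,9), (1,7,10),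
  (1,9,11), (2,3,4), (2,3,5), (2,3,9), (2,3,10), (2,3,11), (2,4,5), (2,4,7), (2,4,9), (2,4,11),
  (2,5,6), (2,5,7), (2,5,10), (2,7,9), (2,7,10), (2,8,11), (2,9,10), (2,9,11), (2,10,11),
  (3,4,5), (3,4,6), (3,4,10), (3,4,11), (3,5,6), (3,5,8), (3,5,10), (3,6,7), (3,6,8), (3,6,11),
  (3,8,10), (3,8,11), (3,10,11), (4,5,6), (4,5,7), (4,5,11), (4,6,7), (4,6,9), (4,6,11),
  (4,7,8), (4,7,9), (4,9,11), (5,6,7), (5,6,8), (5,7,8), (5,7,10), (5,8,9), (5,8,10), (6,7,8),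
  (6,7,9), (6,8,9), (6,8,11), (6,9,10), (6,9,11), (7,8,9), (7,8,10), (7,9,10), (7,10,11),
  (8,9,10), (8,9,11), (8,10,11), (9,10,11)]

/-- The listed homogeneous cubic bent functions in 12 variables. -/
def known12 : Set (BoolFun 12) := {h12_1, h12_2, h12_3, h12_4, h12_5}

end CubicBent

namespace CubicBent

/-! ### Equivalence of Boolean functions -/

/-! For a cubic form the second derivative in directions `a`, `b` is affine in the base point, with
linear part the polar trilinear form `tri` (`deriv2_cubicForm`). Hence `rad f a` is the kernel of an
alternating matrix depending linearly on `a`. An equivalence acts on second derivatives through its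
linear part alone (`Equivalent.exists_linearEquiv`), so anything defined from these kernels is an
invariant.

Membership in `ℳ^#` is shown by an explicit `m`-dimensional space on which second derivatives
vanish, with first derivatives that permute a complement (`mem_completedMM_of_isotropic`); bentness
then comes for free. For the two functions outside `ℳ^#`, bentness holds because every `a ≠ 0` has a
`b` whose second derivative is constantly 1 (`isBent_of_deriv2_eq_one`). They are excluded from
`ℳ^#` because membership would give a set `U` of `2 ^ m` directions with vanishing second
derivatives. Every `a` in `U` has `U` inside the set of directions isotropic to `a`, and this local
condition leaves too few candidates (`not_mem_completedMM_of_checkAll`).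

In 10 variables, `ℳ^#` separates the first two functions from the last two; within these pairs, the
least size of a kernel and the size of the radical (the `a` with zero matrix) decide. In 12
variables the radical has at least 4 elements for `h12_1`, `h12_2`, `h12_4`, two or three for
`h12_3`, and one for `h12_5`. Of the first group, `h12_4` has a matrix of rank two and `h12_1` has
none. The form of `h12_2` is linear over the field with 4 elements modulo its radical, so no kernel
determines its direction, whereas `h12_1` and `h12_4` each have such a kernel.

The finite checks run over all `2 ^ n` directions, with a vector and its matrix packed in one
natural number (`exists_codes_of_checkAll`). -/

lemma two_eq_zero : (2 : ZMod 2) = 0 := by decide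

lemma vec_add_self {n : ℕ} (x : Fin n → ZMod 2) : x + x = 0 :=
  funext fun i => CharTwo.add_self_eq_zero (x i)

lemma eq_sum_smul_single {n : ℕ} (a : Fin n → ZMod 2) : a = ∑ i, a i • Pi.single i 1 := by
  ext j
  simp [Finset.sum_apply, Pi.single_apply]

lemma Equivalent.refl {n : ℕ} (f : BoolFun n) : Equivalent f f :=
  ⟨AffineEquiv.refl _ _, 0, 0, fun x => by simp⟩

/-- The affine correction terms must be pulled back along affine maps to make `Equivalent` symmetric
and transitive. -/
lemma exists_affine_comp {n : ℕ} (A : (Fin n → ZMod 2) ≃ᵃ[ZMod 2] (Fin n → ZMod 2))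
    (a : Fin n → ZMod 2) (b : ZMod 2) :
    ∃ (a' : Fin n → ZMod 2) (b' : ZMod 2), ∀ x, a ⬝ᵥ A x + b = a' ⬝ᵥ x + b' := by
  refine ⟨fun i => a ⬝ᵥ A.linear (Pi.single i 1), a ⬝ᵥ A 0 + b, fun x => ?_⟩
  have h1 : A x = A.linear x + A 0 := by
    have := A.map_vadd 0 x
    simpa using this
  have h2 : a ⬝ᵥ A.linear x = (fun i => a ⬝ᵥ A.linear (Pi.single i 1)) ⬝ᵥ x := by
    let g : (Fin n → ZMod 2) →ₗ[ZMod 2] ZMod 2 :=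
      (dotProductBilin (ZMod 2) (ZMod 2) a).comp A.linear.toLinearMap
    have := g.pi_apply_eq_sum_univ x
    have e : ∀ y, g y = a ⬝ᵥ A.linear y := fun y => rfl
    rw [← e, this, dotProduct]
    refine Finset.sum_congr rfl fun i _ => ?_
    rw [smul_eq_mul, mul_comm, e]
    congr 3
    ext j
    simp [Pi.single_apply, eq_comm]
  rw [h1, dotProduct_add, h2]
  ring

lemma Equivalent.symm {n : ℕ} {f g : BoolFun n} (h : Equivalent f g) : Equivalent g f := by
  obtain ⟨A, a, b, h⟩ := h
  obtain ⟨a', b', h'⟩ := exists_affine_comp A.symm a b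
  refine ⟨A.symm, a', b', fun x => ?_⟩
  rw [h, ← h', AffineEquiv.apply_symm_apply, add_assoc, CharTwo.add_self_eq_zero, add_zero]

lemma Equivalent.trans {n : ℕ} {f g k : BoolFun n} (h₁ : Equivalent f g)
    (h₂ : Equivalent g k) : Equivalent f k := by
  obtain ⟨A, a, b, h₁⟩ := h₁
  obtain ⟨B, c, d, h₂⟩ := h₂
  obtain ⟨a', b', h'⟩ := exists_affine_comp B a b
  refine ⟨B.trans A, a' + c, b' + d, fun x => ?_⟩
  rw [h₂, h₁, h', AffineEquiv.trans_apply, add_dotProduct]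
  ring

lemma equivalent_of_equivClass_eq {n : ℕ} {f g : BoolFun n} (h : equivClass f = equivClass g) :
    Equivalent f g := by
  have : g ∈ equivClass g := Equivalent.refl g
  rwa [← h] at this

/-! ### Second derivatives and radicals -/

/-- The second-order derivative of `f` in the directions `a` and `b`. -/
def deriv2 {n : ℕ} (f : BoolFun n) (a b x : Fin n → ZMod 2) : ZMod 2 :=
  f (x + a + b) + f (x + a) + f (x + b) + f x

/-- The directions `b` for which the second derivative in the directions `a`, `b` is constant. -/
def rad {n : ℕ} (f : BoolFun n) (a : Fin n → ZMod 2) : Set (Fin n → ZMod 2) :=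
  {b | ∀ x, deriv2 f a b x = deriv2 f a b 0}

/-- The added affine function has constant first derivatives and zero second derivatives, and the
translation part of the affine map only moves the base point. -/
lemma Equivalent.exists_linearEquiv {n : ℕ} {f f' : BoolFun n} (h : Equivalent f f') :
    ∃ (A : (Fin n → ZMod 2) ≃ (Fin n → ZMod 2))
      (L : (Fin n → ZMod 2) ≃ₗ[ZMod 2] (Fin n → ZMod 2)),
      (∀ x a, A (x + a) = A x + L a) ∧
      (∀ a, ∃ c, ∀ x, derivative a f' x = derivative (L a) f (A x) + c) ∧
      ∀ a b x, deriv2 f' a b x = deriv2 f (L a) (L b) (A x) := by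
  obtain ⟨A, c, d, h⟩ := h
  have hA : ∀ x a, A (x + a) = A x + A.linear a := fun x a => by
    have := A.map_vadd x a
    simp only [vadd_eq_add] at this
    rw [add_comm x, this, add_comm]
  refine ⟨A.toEquiv, A.linear, hA, fun a => ⟨c ⬝ᵥ a, fun x => ?_⟩, fun a b x => ?_⟩
  · simp only [derivative, AffineEquiv.coe_toEquiv, h, hA, dotProduct_add]
    linear_combination (d + c ⬝ᵥ x) * two_eq_zero
  · simp only [deriv2, AffineEquiv.coe_toEquiv, h, hA, dotProduct_add]
    generalize f (A x + A.linear a + A.linear b) = p, f (A x + A.linear a) = q,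
      f (A x + A.linear b) = r, f (A x) = s
    linear_combination (2 * d + 2 * (c ⬝ᵥ x) + c ⬝ᵥ a + c ⬝ᵥ b) * two_eq_zero

/-- All invariants below are built from `rad` and linear algebra, so this one linear map transports
each of them. -/
lemma Equivalent.exists_rad {n : ℕ} {f f' : BoolFun n} (h : Equivalent f f') :
    ∃ L : (Fin n → ZMod 2) ≃ₗ[ZMod 2] (Fin n → ZMod 2),
      ∀ a b, b ∈ rad f' a ↔ L b ∈ rad f (L a) := by
  obtain ⟨A, L, -, -, h⟩ := h.exists_linearEquiv
  refine ⟨L, fun a b => ?_⟩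
  simp only [rad, Set.mem_ofPred_eq, h]
  constructor
  · intro H x
    obtain ⟨y, rfl⟩ := A.surjective x
    -- Constancy is normalised at 0, which `A` need not fix; the comparison goes through the point
    -- that `A` sends to 0.
    obtain ⟨z, hz⟩ := A.surjective 0
    have h3 := H z
    rw [hz] at h3
    rw [H y, h3]
  · intro H x
    rw [H (A x), H (A 0)]

/-! ### Bentness -/

/-- The injection sends each of the two level sets into the other, so they have equal size and
complement each other. -/
lemma two_mul_ncard_of_flip {α : Type*} [Finite α] (F : α → ZMod 2) (σ : α → α)
    (hσ : Function.Injective σ) (h : ∀ x, F (σ x) = F x + 1) (b : ZMod 2) :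
    2 * {x | F x = b}.ncard = Nat.card α := by
  have key : ∀ c, {x | F x = c}.ncard ≤ {x | F x = c + 1}.ncard := fun c =>
    Set.ncard_le_ncard_of_injOn σ (fun x hx => by
      simp only [Set.mem_ofPred_eq] at hx ⊢
      rw [h, hx]) hσ.injOn
  have h1 := key b
  have h2 := key (b + 1)
  rw [add_assoc, CharTwo.add_self_eq_zero, add_zero] at h2
  have h3 : {x | F x = b + 1} = {x | F x = b}ᶜ := by
    ext x
    simp only [Set.mem_ofPred_eq, Set.mem_compl_iff]
    have : ∀ b c : ZMod 2, c = b + 1 ↔ ¬c = b := by decide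
    exact this _ _
  have h4 := Set.ncard_add_ncard_compl {x | F x = b}
  rw [← h3] at h4
  omega

lemma isBent_of_flip {n : ℕ} {f : BoolFun n}
    (H : ∀ a, a ≠ 0 → ∃ σ : (Fin n → ZMod 2) → (Fin n → ZMod 2), Function.Injective σ ∧
      ∀ x, derivative a f (σ x) = derivative a f x + 1) : IsBent f := by
  intro a ha b
  obtain ⟨σ, hσ, h⟩ := H a ha
  have h1 := two_mul_ncard_of_flip _ σ hσ h b
  -- The exponent `n - 1` is truncated, so dimension 0 has to be excluded; there no `a ≠ 0` exists.
  have hn : n ≠ 0 := by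
    rintro rfl
    exact ha (Subsingleton.elim _ _)
  obtain ⟨k, rfl⟩ := Nat.exists_eq_succ_of_ne_zero hn
  simp only [Nat.card_eq_fintype_card, Fintype.card_pi, ZMod.card, Finset.prod_const,
    Finset.card_univ, Fintype.card_fin, Nat.succ_eq_add_one, pow_succ] at h1
  simp only [Nat.succ_eq_add_one, Nat.add_sub_cancel]
  omega

/-- Translation by `b` then flips the first derivative in direction `a`. -/
lemma isBent_of_deriv2_eq_one {n : ℕ} {f : BoolFun n}
    (H : ∀ a, a ≠ 0 → ∃ b, ∀ x, deriv2 f a b x = 1) : IsBent f := by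
  refine isBent_of_flip fun a ha => ?_
  obtain ⟨b, hb⟩ := H a ha
  refine ⟨fun x => x + b, add_left_injective b, fun x => ?_⟩
  have := hb x
  unfold deriv2 at this
  simp only [derivative]
  rw [add_right_comm x a b] at this
  linear_combination this - (f (x + a) + f x) * two_eq_zero

lemma Equivalent.isBent {n : ℕ} {f f' : BoolFun n} (h : Equivalent f f') (hf : IsBent f) :
    IsBent f' := by
  obtain ⟨A, L, -, h, -⟩ := h.exists_linearEquiv
  intro a ha b
  obtain ⟨c, hc⟩ := h a
  rw [← hf (L a) (by simpa using ha) (b + c), ← Set.ncard_image_of_injective _ A.injective]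
  congr 1
  ext x
  simp only [Set.mem_image, Set.mem_ofPred_eq, hc]
  constructor
  · rintro ⟨y, rfl, rfl⟩
    rw [add_assoc, CharTwo.add_self_eq_zero, add_zero]
  · intro hx
    exact ⟨A.symm x, by rw [A.apply_symm_apply, hx, add_assoc, CharTwo.add_self_eq_zero, add_zero],
      A.apply_symm_apply x⟩

/-! ### The Maiorana-McFarland class -/

lemma append_add_append {m : ℕ} (x x' y y' : Fin m → ZMod 2) :
    Fin.append x y + Fin.append x' y' = Fin.append (x + x') (y + y') := by
  ext i
  refine Fin.addCases (fun i => ?_) (fun i => ?_) i <;> simp [-Fin.natAdd_eq_addNat]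

lemma exists_append {m : ℕ} (z : Fin (m + m) → ZMod 2) : ∃ x y, z = Fin.append x y :=
  ⟨_, _, (Fin.append_castAdd_natAdd (f := z)).symm⟩

lemma append_inj {m : ℕ} {x x' y y' : Fin m → ZMod 2}
    (h : Fin.append x y = Fin.append x' y') : x = x' ∧ y = y' := by
  constructor
  · ext i
    simpa using congrFun h (Fin.castAdd m i)
  · ext i
    simpa [-Fin.natAdd_eq_addNat] using congrFun h (Fin.natAdd m i)

lemma exists_dotProduct_eq_one {m : ℕ} {c : Fin m → ZMod 2} (hc : c ≠ 0) : ∃ e, e ⬝ᵥ c = 1 := by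
  obtain ⟨i, hi⟩ := Function.ne_iff.mp hc
  refine ⟨Pi.single i 1, ?_⟩
  rw [single_dotProduct, one_mul]
  exact Fin.eq_one_of_ne_zero (c i) hi

/-- The derivative in direction `(a₁, a₂)` is `⟨x, π (y + a₂) + π y⟩` plus a function of `y`. If `a₂
= 0` it reduces to `⟨a₁, π y⟩`, which flips when `π y` moves by some `e` with `⟨e, a₁⟩ = 1`. If `a₂
≠ 0`, the coefficient of `x` never vanishes because `π` is injective, and shifting `x` by a suitable
`e y` flips the value. -/
lemma isBent_of_mem_maioranaMcFarland {m : ℕ} {g : BoolFun (m + m)}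
    (hg : g ∈ maioranaMcFarland m) : IsBent g := by
  obtain ⟨π, φ, hg⟩ := hg
  refine isBent_of_flip fun a ha => ?_
  obtain ⟨a₁, a₂, rfl⟩ := exists_append a
  have hD : ∀ x y, derivative (Fin.append a₁ a₂) g (Fin.append x y) =
      x ⬝ᵥ (π (y + a₂) + π y) + a₁ ⬝ᵥ π (y + a₂) + φ (y + a₂) + φ y := fun x y => by
    simp only [derivative, append_add_append, hg, dotProduct_add, add_dotProduct]
    ring
  have hp : ∀ z : Fin (m + m) → ZMod 2, Fin.append (fun i => z (Fin.castAdd m i))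
      (fun i => z (Fin.natAdd m i)) = z := fun z => Fin.append_castAdd_natAdd
  by_cases h2 : a₂ = 0
  · subst h2
    have h1 : a₁ ≠ 0 := by
      rintro rfl
      apply ha
      ext i
      refine Fin.addCases (fun i => ?_) (fun i => ?_) i <;> simp [-Fin.natAdd_eq_addNat]
    obtain ⟨e, he⟩ := exists_dotProduct_eq_one h1
    refine ⟨fun z => Fin.append (fun i => z (Fin.castAdd m i))
      (π.symm (π (fun i => z (Fin.natAdd m i)) + e)), fun z w hzw => ?_, fun z => ?_⟩
    · obtain ⟨h3, h4⟩ := append_inj hzw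
      have h5 := π.injective (add_right_cancel (π.symm.injective h4))
      rw [← hp z, ← hp w, h3, h5]
    · conv_rhs => rw [← hp z]
      rw [hD, hD]
      simp only [add_zero, Equiv.apply_symm_apply, vec_add_self, dotProduct_zero, zero_add,
        dotProduct_add a₁, dotProduct_comm a₁ e, he]
      rw [add_assoc _ (φ _) (φ _), CharTwo.add_self_eq_zero, add_assoc _ (φ _) (φ _),
        CharTwo.add_self_eq_zero, add_zero, add_zero]
  · have hc : ∀ y, π (y + a₂) + π y ≠ 0 := fun y h => h2 (by
      have := π.injective (sub_eq_zero.mp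
        ((sub_eq_add_neg _ _).trans ((congrArg _ (neg_eq_of_add_eq_zero_left
          (vec_add_self (π y)))).trans h)))
      simpa using this)
    choose e he using fun y => exists_dotProduct_eq_one (hc y)
    refine ⟨fun z => Fin.append ((fun i => z (Fin.castAdd m i)) + e (fun i => z (Fin.natAdd m i)))
      (fun i => z (Fin.natAdd m i)), fun z w hzw => ?_, fun z => ?_⟩
    · obtain ⟨h3, h4⟩ := append_inj hzw
      rw [h4] at h3
      have h5 := add_right_cancel h3
      rw [← hp z, ← hp w, h4, h5]
    · conv_rhs => rw [← hp z]
      rw [hD, hD, add_dotProduct, he]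
      ring

lemma isBent_of_mem_completedMM {m : ℕ} {f : BoolFun (m + m)} (hf : f ∈ completedMM m) :
    IsBent f := by
  obtain ⟨g, hg, h⟩ := hf
  exact h.isBent (isBent_of_mem_maioranaMcFarland hg)

lemma equivClass_subset_completedMM {m : ℕ} {f : BoolFun (m + m)} (hf : f ∈ completedMM m) :
    equivClass f ⊆ completedMM m := by
  obtain ⟨g, hg, h⟩ := hf
  exact fun k hk => ⟨g, hg, h.trans hk⟩

/-- A function equivalent to a Maiorana-McFarland function has vanishing second derivatives on a
set of `2 ^ m` directions. -/
lemma exists_isotropic_of_mem_completedMM {m : ℕ} {f : BoolFun (m + m)}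
    (hf : f ∈ completedMM m) :
    ∃ U : Finset (Fin (m + m) → ZMod 2), U.card = 2 ^ m ∧
      ∀ a ∈ U, ∀ b ∈ U, ∀ x, deriv2 f a b x = 0 := by
  classical
  obtain ⟨g, ⟨π, φ, hg⟩, h⟩ := hf
  obtain ⟨A, L, -, -, h⟩ := h.exists_linearEquiv
  -- The set is the preimage of the subspace `y = 0`: a Maiorana-McFarland function is affine in `x`
  -- for fixed `y`. Only the size of this set is needed later, not its linearity.
  refine ⟨Finset.univ.image fun x : Fin m → ZMod 2 => L.symm (Fin.append x 0), ?_, ?_⟩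
  · rw [Finset.card_image_of_injective]
    · simp [ZMod.card]
    · intro x y hxy
      exact (append_inj (L.symm.injective hxy)).1
  · simp only [Finset.mem_image, Finset.mem_univ, true_and]
    rintro _ ⟨x, rfl⟩ _ ⟨y, rfl⟩ z
    rw [h, LinearEquiv.apply_symm_apply, LinearEquiv.apply_symm_apply]
    obtain ⟨u, v, hz⟩ := exists_append (A z)
    rw [hz]
    simp only [deriv2, append_add_append, hg, add_zero, add_dotProduct]
    generalize u ⬝ᵥ π v = p, x ⬝ᵥ π v = q, y ⬝ᵥ π v = r, φ v = s
    revert p q r s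
    decide

lemma disjoint_equivClass_completedMM {m : ℕ} {f : BoolFun (m + m)}
    (hf : f ∉ completedMM m) : Disjoint (equivClass f) (completedMM m) := by
  rw [Set.disjoint_left]
  rintro k hk ⟨g, hg, h⟩
  exact hf ⟨g, hg, h.trans (Equivalent.symm hk)⟩

/-- Vanishing second derivatives make the derivative along `u i` invariant under translation by each
`u j`, so `f` is affine on every coset of the span. -/
lemma apply_sum_smul_add {n : ℕ} {ι : Type*} (f : BoolFun n)
    (u : ι → Fin n → ZMod 2) (hu : ∀ i j x, deriv2 f (u i) (u j) x = 0) (s : Finset ι)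
    (x : ι → ZMod 2) :
    ∀ w, f (∑ i ∈ s, x i • u i + w) = ∑ i ∈ s, x i * derivative (u i) f w + f w := by
  classical
  have h1 : ∀ i j w, derivative (u i) f (w + u j) = derivative (u i) f w := fun i j w => by
    have := hu i j w
    unfold deriv2 at this
    unfold derivative
    rw [add_right_comm w (u i)] at this
    linear_combination this - (f (w + u i) + f w) * two_eq_zero
  have h2 : ∀ i j (c : ZMod 2) w, derivative (u i) f (c • u j + w) = derivative (u i) f w := by
    intro i j c w
    obtain rfl | rfl : c = 0 ∨ c = 1 := by revert c; decide
    · simp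
    · rw [one_smul, add_comm, h1]
  induction s using Finset.induction_on with
  | empty => simp
  | insert j s hj ih =>
    intro w
    rw [Finset.sum_insert hj, Finset.sum_insert hj, add_comm (x j • u j), add_assoc, ih]
    simp only [h2]
    rw [add_assoc, add_comm (x j * _), add_assoc]
    congr 1
    generalize x j = c
    obtain rfl | rfl : c = 0 ∨ c = 1 := by revert c; decide
    · simp
    · rw [one_smul, one_mul, derivative, add_comm w, add_comm (f w), add_assoc,
        CharTwo.add_self_eq_zero, add_zero]

/-- A function with vanishing second derivatives on the span of `m` members of a basis, whose
first derivatives in these directions induce a permutation of a complement, belongs to `ℳ^#`. -/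
lemma mem_completedMM_of_isotropic {m : ℕ} (f : BoolFun (m + m))
    (u v : Fin m → Fin (m + m) → ZMod 2)
    (hspan : ∀ k, ∃ z : Fin (m + m) → ZMod 2,
      ∑ i, z (Fin.castAdd m i) • u i + ∑ i, z (Fin.natAdd m i) • v i = Pi.single k 1)
    (hu : ∀ i j x, deriv2 f (u i) (u j) x = 0)
    (hperm : Function.Surjective fun (y : Fin m → ZMod 2) (i : Fin m) =>
      derivative (u i) f (∑ j, y j • v j)) :
    f ∈ completedMM m := by
  let Φ : (Fin (m + m) → ZMod 2) →ₗ[ZMod 2] (Fin (m + m) → ZMod 2) :=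
    { toFun := fun z => ∑ i, z (Fin.castAdd m i) • u i + ∑ i, z (Fin.natAdd m i) • v i
      map_add' := fun z w => by
        simp only [Pi.add_apply, add_smul, Finset.sum_add_distrib]
        abel
      map_smul' := fun c z => by
        simp only [Pi.smul_apply, smul_eq_mul, mul_smul, ← Finset.smul_sum, smul_add,
          RingHom.id_apply] }
  have hsurj : Function.Surjective Φ := fun x => by
    choose z hz using hspan
    have hz' : ∀ k, Φ (z k) = Pi.single k 1 := hz
    refine ⟨∑ k, x k • z k, ?_⟩
    rw [map_sum]
    simp only [map_smul, hz']
    exact (eq_sum_smul_single x).symm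
  have hbij : Function.Bijective Φ := ⟨Finite.injective_iff_surjective.mpr hsurj, hsurj⟩
  let E : (Fin (m + m) → ZMod 2) ≃ₗ[ZMod 2] (Fin (m + m) → ZMod 2) :=
    LinearEquiv.ofBijective Φ hbij
  -- In the coordinates given by `u` and `v`, the vector of derivatives along the `u i` is `π`, and
  -- the restriction of `f` to the span of the `v j` is `φ`.
  refine ⟨fun z => f (E z), ⟨Equiv.ofBijective _
    ⟨Finite.injective_iff_surjective.mpr hperm, hperm⟩, fun y => f (∑ j, y j • v j),
    fun x y => ?_⟩, Equivalent.symm ⟨E.toAffineEquiv, 0, 0, fun x => by simp⟩⟩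
  have h1 : E (Fin.append x y) = ∑ i, x i • u i + ∑ j, y j • v j := by
    change ∑ i, Fin.append x y (Fin.castAdd m i) • u i +
      ∑ i, Fin.append x y (Fin.natAdd m i) • v i = _
    simp only [Fin.append_left, Fin.append_right]
  change f (E (Fin.append x y)) = _
  rw [h1, apply_sum_smul_add f u hu]
  rfl

/-! ### Cubic forms -/

/-- The trilinear form polarizing `cubicForm l`. -/
def tri {n : ℕ} (l : List (Fin n × Fin n × Fin n)) (a b c : Fin n → ZMod 2) : ZMod 2 :=
  (l.map fun t => a t.1 * (b t.2.1 * c t.2.2 + c t.2.1 * b t.2.2) +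
    a t.2.1 * (b t.1 * c t.2.2 + c t.1 * b t.2.2) +
    a t.2.2 * (b t.1 * c t.2.1 + c t.1 * b t.2.1)).sum

lemma tri_swap_right {n : ℕ} (l : List (Fin n × Fin n × Fin n)) (a b c : Fin n → ZMod 2) :
    tri l a b c = tri l a c b := by
  unfold tri
  congr 2
  ext t
  ring

lemma tri_swap_left {n : ℕ} (l : List (Fin n × Fin n × Fin n)) (a b c : Fin n → ZMod 2) :
    tri l a b c = tri l b a c := by
  unfold tri
  congr 2
  ext t
  ring

lemma tri_add_left {n : ℕ} (l : List (Fin n × Fin n × Fin n)) (a a' b c : Fin n → ZMod 2) :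
    tri l (a + a') b c = tri l a b c + tri l a' b c := by
  unfold tri
  rw [← List.sum_map_add]
  congr 2
  ext t
  simp only [Pi.add_apply]
  ring

lemma tri_add_mid {n : ℕ} (l : List (Fin n × Fin n × Fin n)) (a b b' c : Fin n → ZMod 2) :
    tri l a (b + b') c = tri l a b c + tri l a b' c := by
  rw [tri_swap_left, tri_add_left, tri_swap_left l b, tri_swap_left l b']

lemma tri_smul_left {n : ℕ} (l : List (Fin n × Fin n × Fin n)) (r : ZMod 2)
    (a b c : Fin n → ZMod 2) : tri l (r • a) b c = r * tri l a b c := by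
  unfold tri
  rw [← List.sum_map_mul_left]
  congr 2
  ext t
  simp only [Pi.smul_apply, smul_eq_mul]
  ring

lemma tri_sum_smul_left {n : ℕ} {ι : Type*} (l : List (Fin n × Fin n × Fin n)) (s : Finset ι)
    (r : ι → ZMod 2) (v : ι → Fin n → ZMod 2) (b c : Fin n → ZMod 2) :
    tri l (∑ i ∈ s, r i • v i) b c = ∑ i ∈ s, r i * tri l (v i) b c := by
  classical
  induction s using Finset.induction_on with
  | empty => simpa using tri_smul_left l 0 0 b c
  | insert j s hj ih =>
    rw [Finset.sum_insert hj, Finset.sum_insert hj, tri_add_left, tri_smul_left, ih]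

lemma tri_eq_sum_left {n : ℕ} (l : List (Fin n × Fin n × Fin n)) (a b c : Fin n → ZMod 2) :
    tri l a b c = ∑ i, a i * tri l (Pi.single i 1) b c := by
  conv_lhs => rw [eq_sum_smul_single a]
  rw [tri_sum_smul_left]

lemma tri_eq_sum_mid {n : ℕ} (l : List (Fin n × Fin n × Fin n)) (a b c : Fin n → ZMod 2) :
    tri l a b c = ∑ i, b i * tri l a (Pi.single i 1) c := by
  rw [tri_swap_left, tri_eq_sum_left]
  exact Finset.sum_congr rfl fun i _ => by rw [tri_swap_left]

lemma tri_eq_sum_right {n : ℕ} (l : List (Fin n × Fin n × Fin n)) (a b c : Fin n → ZMod 2) :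
    tri l a b c = ∑ i, c i * tri l a b (Pi.single i 1) := by
  rw [tri_swap_right, tri_eq_sum_mid]
  exact Finset.sum_congr rfl fun i _ => by rw [tri_swap_right]

/-- Terms of degree two and more in `x` cancel in characteristic 2. The constant term is kept
implicit, since only its value at 0 is ever evaluated. -/
lemma deriv2_cubicForm {n : ℕ} (l : List (Fin n × Fin n × Fin n)) (a b x : Fin n → ZMod 2) :
    deriv2 (cubicForm l) a b x = deriv2 (cubicForm l) a b 0 + tri l a b x := by
  induction l with
  | nil => simp [deriv2, cubicForm, tri]
  | cons t l ih =>
    simp only [deriv2, cubicForm, tri, List.map_cons, List.sum_cons, Pi.add_apply,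
      Pi.zero_apply] at ih ⊢
    generalize x t.1 = x₁, x t.2.1 = x₂, x t.2.2 = x₃, a t.1 = a₁, a t.2.1 = a₂, a t.2.2 = a₃,
      b t.1 = b₁, b t.2.1 = b₂, b t.2.2 = b₃
    linear_combination ih + (x₁ * x₂ * a₃ + x₁ * x₂ * b₃ + x₁ * a₂ * x₃ + x₁ * a₂ * a₃ +
      x₁ * b₂ * x₃ + x₁ * b₂ * b₃ + a₁ * x₂ * x₃ + a₁ * x₂ * a₃ + a₁ * a₂ * x₃ + b₁ * x₂ * x₃ +
      b₁ * x₂ * b₃ + b₁ * b₂ * x₃ + 2 * x₁ * x₂ * x₃) * two_eq_zero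

lemma mem_rad_cubicForm {n : ℕ} (l : List (Fin n × Fin n × Fin n)) (a b : Fin n → ZMod 2) :
    b ∈ rad (cubicForm l) a ↔ ∀ k, tri l a b (Pi.single k 1) = 0 := by
  constructor
  · intro h k
    have := h (Pi.single k 1)
    rwa [deriv2_cubicForm, add_eq_left] at this
  · intro h x
    rw [deriv2_cubicForm, tri_eq_sum_right]
    simp [h]

lemma rad_cubicForm_eq_univ {n : ℕ} (l : List (Fin n × Fin n × Fin n)) (a : Fin n → ZMod 2) :
    (∀ b, b ∈ rad (cubicForm l) a) ↔
      ∀ j k, tri l a (Pi.single j 1) (Pi.single k 1) = 0 := by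
  simp only [mem_rad_cubicForm]
  refine ⟨fun h j k => h _ k, fun h b k => ?_⟩
  rw [tri_eq_sum_mid]
  simp [h]

lemma tri_eq_zero_of_mem_rad {n : ℕ} {l : List (Fin n × Fin n × Fin n)} {a b : Fin n → ZMod 2}
    (h : b ∈ rad (cubicForm l) a) (c : Fin n → ZMod 2) : tri l a b c = 0 := by
  rw [mem_rad_cubicForm] at h
  rw [tri_eq_sum_right]
  simp [h]

/-- The algebraic normal form of `cubicForm l`. -/
def cubicCoeff {n : ℕ} (l : List (Fin n × Fin n × Fin n)) (v : Finset (Fin n)) : ZMod 2 :=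
  (l.map fun t => if v = {t.1, t.2.1, t.2.2} then 1 else 0).sum

lemma isANF_cubicForm {n : ℕ} (l : List (Fin n × Fin n × Fin n))
    (hl : ∀ t ∈ l, t.1 < t.2.1 ∧ t.2.1 < t.2.2) : IsANF (cubicForm l) (cubicCoeff l) := by
  intro x
  induction l with
  | nil => simp [cubicForm, cubicCoeff]
  | cons t l ih =>
    have ih := ih fun s hs => hl s (List.mem_cons_of_mem _ hs)
    obtain ⟨h1, h2⟩ := hl t List.mem_cons_self
    simp only [cubicForm, cubicCoeff, List.map_cons, List.sum_cons, add_mul,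
      Finset.sum_add_distrib] at ih ⊢
    rw [ih, add_left_inj]
    simp only [ite_mul, one_mul, zero_mul, Finset.sum_ite_eq', Finset.mem_univ, if_true]
    rw [Finset.prod_insert, Finset.prod_pair h2.ne, mul_assoc]
    simp [h1.ne, (h1.trans h2).ne]

lemma card_eq_three_of_cubicCoeff_ne_zero {n : ℕ} (l : List (Fin n × Fin n × Fin n))
    (hl : ∀ t ∈ l, t.1 < t.2.1 ∧ t.2.1 < t.2.2) (v : Finset (Fin n))
    (hv : cubicCoeff l v ≠ 0) : v.card = 3 := by
  by_contra hc
  apply hv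
  apply List.sum_eq_zero
  intro c hmem
  obtain ⟨t, ht, rfl⟩ := List.mem_map.mp hmem
  obtain ⟨h1, h2⟩ := hl t ht
  rw [if_neg]
  rintro rfl
  exact hc (Finset.card_eq_three.mpr ⟨_, _, _, h1.ne, (h1.trans h2).ne, h2.ne, rfl⟩)

/-- Strictly increasing triples give monomials of degree exactly 3. Bentness rules out total
cancellation: the zero function has zero derivatives, which never take the value 1. -/
lemma isHomogeneousCubicBent_cubicForm {n : ℕ} (hn : n ≠ 0)
    (l : List (Fin n × Fin n × Fin n))
    (hl : l.all (fun t => Nat.blt t.1 t.2.1 && Nat.blt t.2.1 t.2.2) = true)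
    (hb : IsBent (cubicForm l)) : IsHomogeneousCubicBent (cubicForm l) := by
  have hl : ∀ t ∈ l, t.1 < t.2.1 ∧ t.2.1 < t.2.2 := fun t ht => by
    have := List.all_eq_true.mp hl t ht
    rw [Bool.and_eq_true] at this
    exact ⟨Nat.blt_eq.mp this.1, Nat.blt_eq.mp this.2⟩
  have hA := isANF_cubicForm l hl
  have h3 := card_eq_three_of_cubicCoeff_ne_zero l hl
  refine ⟨⟨_, hA, fun v hv => (h3 v hv).le, ?_⟩, ⟨_, hA, h3⟩, hb⟩
  by_contra! H
  have h0 : ∀ v, cubicCoeff l v = 0 := fun v => by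
    by_contra hv
    exact H v hv (h3 v hv)
  have hz : ∀ x, cubicForm l x = 0 := fun x => by
    rw [hA x]
    simp [h0]
  have := hb (fun _ => 1) (fun h => by
    have := congrFun h ⟨0, Nat.pos_of_ne_zero hn⟩
    exact one_ne_zero this) 1
  simp only [derivative, hz, add_zero, zero_ne_one, Set.ofPred_false, Set.ncard_empty] at this
  exact (pow_pos two_pos _).ne this

/-! ### Words: vectors and matrices over `𝔽₂` coded by natural numbers -/

/-- Evaluates `m` before passing it to `k`. -/
def force {α : Type} (m : ℕ) (k : ℕ → α) : α :=
  match m with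
  | 0 => k 0
  | m + 1 => k (m + 1)

/-- The bit of `m` at position `k`. -/
def tb (m k : ℕ) : Bool := Nat.beq (Nat.land (Nat.shiftRight m k) 1) 1

/-- The sum of the members of `ws` selected by the bits of `c`. -/
def combine : List ℕ → ℕ → ℕ
  | [], _ => 0
  | w :: ws, c => cond (tb c 0) (Nat.xor w (combine ws (c / 2))) (combine ws (c / 2))

/-- Checks `q` on all sums of `acc` with members of `ws`. -/
def allTree (q : ℕ → Bool) : List ℕ → ℕ → Bool
  | [], acc => q acc
  | w :: ws, acc => allTree q ws acc && force (Nat.xor acc w) (allTree q ws)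

/-- The matrix of `tri l e_i` as a word: position `n * j + k` holds `tri l e_i e_j e_k`, and
position `n * n + i` is set. -/
def word (n : ℕ) : List (Fin n × Fin n × Fin n) → ℕ → ℕ
  | [], i => 2 ^ (n * n + i)
  | t :: l, i =>
    Nat.xor (word n l i)
      (Nat.xor (cond (Nat.beq t.1 i) (Nat.xor (2 ^ (n * t.2.1 + t.2.2)) (2 ^ (n * t.2.2 + t.2.1))) 0)
      (Nat.xor (cond (Nat.beq t.2.1 i) (Nat.xor (2 ^ (n * t.1 + t.2.2)) (2 ^ (n * t.2.2 + t.1))) 0)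
        (cond (Nat.beq t.2.2 i) (Nat.xor (2 ^ (n * t.1 + t.2.1)) (2 ^ (n * t.2.1 + t.1))) 0)))

/-- Evaluates a list of numbers before passing it to `k`. -/
def forceMap {α : Type} (f : ℕ → ℕ) : List ℕ → (List ℕ → α) → α
  | [], k => k []
  | c :: cs, k => force (f c) fun m => forceMap f cs fun ms => k (m :: ms)

/-- The row of index `j` of a matrix coded by a word. -/
def row (n m j : ℕ) : ℕ := Nat.shiftRight m (n * j) % 2 ^ n

/-- The rows of a matrix, augmented by the identity matrix. -/
def augRows (n m : ℕ) : List ℕ := (List.range n).map fun j => Nat.xor (row n m j) (2 ^ (n + j))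

/-- Adds `w` to the members of the list with bit `k` set. -/
def clearBit (k w : ℕ) : List ℕ → List ℕ
  | [] => []
  | v :: vs => force (cond (tb v k) (Nat.xor v w) v) fun u => u :: clearBit k w vs

/-- Eliminates bit `k`: the result spans the elements with bit `k` unset in the span of the list. -/
def elimBit (k : ℕ) : List ℕ → List ℕ
  | [] => []
  | w :: ws => cond (tb w k) (clearBit k w ws) (w :: elimBit k ws)

/-- Eliminates the bits below `k`. -/
def elim : ℕ → List ℕ → List ℕ
  | 0, ws => ws
  | k + 1, ws => elim k (elimBit k ws)

/-- The span of a list of words. -/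
def span : List ℕ → List ℕ
  | [] => [0]
  | w :: ws => span ws ++ (span ws).map (Nat.xor w)

/-- The truth table of the coordinate function `x_i` on the codes below `2 ^ n`. -/
def coordTable : ℕ → ℕ → ℕ
  | 0, _ => 0
  | n + 1, i => Nat.lor (coordTable n i)
      (Nat.shiftLeft (cond (Nat.beq n i) (2 ^ 2 ^ n - 1) (coordTable n i)) (2 ^ n))

/-- The truth table of `cubicForm l`. -/
def table (n : ℕ) : List (Fin n × Fin n × Fin n) → ℕ
  | [] => 0
  | t :: l => Nat.xor (table n l) (Nat.land (coordTable n t.1)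
      (Nat.land (coordTable n t.2.1) (coordTable n t.2.2)))

/-- The value of a function with truth table `F`. -/
def look (n F c : ℕ) : Bool := tb F (c % 2 ^ n)

/-- The second derivative of a function with truth table `F`. -/
def look2 (n F a b x : ℕ) : Bool :=
  xor (xor (look n F (Nat.xor (Nat.xor x a) b)) (look n F (Nat.xor x a)))
    (xor (look n F (Nat.xor x b)) (look n F x))

/-! ### Bits of natural numbers as vectors over `𝔽₂` -/

lemma force_eq {α : Type} (m : ℕ) (k : ℕ → α) : force m k = k m := by
  cases m <;> rfl

lemma forceMap_eq {α : Type} (f : ℕ → ℕ) (cs : List ℕ) (k : List ℕ → α) :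
    forceMap f cs k = k (cs.map f) := by
  induction cs generalizing k with
  | nil => rfl
  | cons c cs ih => rw [forceMap, force_eq, ih, List.map_cons]

lemma tb_eq (m k : ℕ) : tb m k = m.testBit k := by
  have : tb m k = Nat.beq (m >>> k &&& 1) 1 := rfl
  rw [this, Nat.and_one_is_mod, Nat.testBit_eq_decide_div_mod_eq, Nat.shiftRight_eq_div_pow,
    Bool.eq_iff_iff, Nat.beq_eq, decide_eq_true_iff]

/-- The value in `𝔽₂` of a bit. -/
def bz (b : Bool) : ZMod 2 := if b then 1 else 0

lemma bz_xor (a b : Bool) : bz (xor a b) = bz a + bz b := by revert a b; decide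

lemma bz_and (a b : Bool) : bz (a && b) = bz a * bz b := by revert a b; decide

lemma bz_injective : Function.Injective bz := by decide

/-- The bit of `m` at position `k` as an element of `𝔽₂`. -/
def bitv (m k : ℕ) : ZMod 2 := bz (m.testBit k)

lemma bitv_xor (m m' k : ℕ) : bitv (Nat.xor m m') k = bitv m k + bitv m' k := by
  have : (Nat.xor m m').testBit k = xor (m.testBit k) (m'.testBit k) := Nat.testBit_xor m m' k
  rw [bitv, this, bz_xor]
  rfl

lemma bitv_zero (k : ℕ) : bitv 0 k = 0 := by simp [bitv, bz]

lemma bitv_two_pow (i k : ℕ) : bitv (2 ^ i) k = if i = k then 1 else 0 := by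
  simp [bitv, bz, Nat.testBit_two_pow]

lemma bitv_shiftRight (m i k : ℕ) : bitv (Nat.shiftRight m i) k = bitv m (i + k) := by
  have : (Nat.shiftRight m i).testBit k = m.testBit (i + k) := Nat.testBit_shiftRight m
  rw [bitv, this, bitv]

lemma bitv_mod_two_pow (m i k : ℕ) : bitv (m % 2 ^ i) k = if k < i then bitv m k else 0 := by
  rw [bitv, Nat.testBit_mod_two_pow]
  split_ifs with h <;> simp [h, bitv, bz]

lemma mod_two_pow_eq_zero {m i : ℕ} (h : ∀ k < i, bitv m k = 0) : m % 2 ^ i = 0 := by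
  apply Nat.eq_of_testBit_eq
  intro k
  apply bz_injective
  have := bitv_mod_two_pow m i k
  rw [bitv] at this
  rw [this]
  split_ifs with hk
  · rw [h k hk]; simp [bz]
  · simp [bz]

lemma bitv_eq_zero_of_mod {m i k : ℕ} (h : m % 2 ^ i = 0) (hk : k < i) : bitv m k = 0 := by
  have := bitv_mod_two_pow m i k
  rw [h, bitv_zero, if_pos hk] at this
  exact this.symm

/-- The vector with code `m`. -/
def vec (n m : ℕ) : Fin n → ZMod 2 := fun i => bitv m i

lemma vec_xor (n m m' : ℕ) : vec n (Nat.xor m m') = vec n m + vec n m' :=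
  funext fun _ => bitv_xor _ _ _

lemma vec_zero (n : ℕ) : vec n 0 = 0 := funext fun _ => bitv_zero _

lemma vec_two_pow {n : ℕ} (k : Fin n) : vec n (2 ^ (k : ℕ)) = Pi.single k 1 := by
  ext i
  rw [vec, bitv_two_pow, Pi.single_apply]
  simp [Fin.ext_iff, eq_comm]

lemma vec_mod (n m : ℕ) : vec n (m % 2 ^ n) = vec n m := by
  ext i
  rw [vec, bitv_mod_two_pow, if_pos i.isLt, vec]

lemma exists_vec_eq {n : ℕ} (x : Fin n → ZMod 2) : ∃ c < 2 ^ n, vec n c = x := by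
  refine ⟨Nat.ofBits fun i => decide (x i = 1), Nat.ofBits_lt_two_pow _, ?_⟩
  ext i
  rw [vec, bitv, Nat.testBit_ofBits_lt _ _ i.isLt]
  generalize x _ = c
  revert c
  decide

lemma vec_injOn {n m m' : ℕ} (hm : m < 2 ^ n) (hm' : m' < 2 ^ n) (h : vec n m = vec n m') :
    m = m' := by
  apply Nat.eq_of_testBit_eq
  intro k
  by_cases hk : k < n
  · exact bz_injective (congrFun h ⟨k, hk⟩)
  · have hle : 2 ^ n ≤ 2 ^ k := Nat.pow_le_pow_right two_pos (not_lt.mp hk)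
    rw [Nat.testBit_lt_two_pow (hm.trans_le hle), Nat.testBit_lt_two_pow (hm'.trans_le hle)]

lemma bitv_half (c k : ℕ) : bitv (c / 2) k = bitv c (k + 1) := by
  rw [bitv, Nat.testBit_div_two, bitv]

/-- `combine` is a vector-matrix product: the bits of `c` are the coefficients and `ws` the rows. -/
lemma bitv_combine (ws : List ℕ) (c p : ℕ) :
    bitv (combine ws c) p = ∑ i ∈ Finset.range ws.length, bitv c i * bitv (ws.getD i 0) p := by
  induction ws generalizing c with
  | nil => simp [combine, bitv_zero]
  | cons w ws ih =>
    rw [combine, List.length_cons, Finset.sum_range_succ']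
    simp only [List.getD_cons_succ, List.getD_cons_zero, ← bitv_half]
    rw [← ih, bitv, tb_eq, add_comm]
    cases h : c.testBit 0
    · simp [bz, bitv, h]
    · have h1 : bitv c 0 = 1 := by rw [bitv, h]; rfl
      have h2 := bitv_xor w (combine ws (c / 2)) p
      rw [h1, one_mul, ← h2, cond_true, bitv]

lemma bitv_combine_map (n : ℕ) (f : ℕ → ℕ) (c p : ℕ) :
    bitv (combine ((List.range n).map f) c) p = ∑ i : Fin n, vec n c i * bitv (f i) p := by
  rw [bitv_combine, List.length_map, List.length_range, Finset.sum_range]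
  refine Finset.sum_congr rfl fun i _ => ?_
  congr 2
  simp

/-- The binary tree branches on whether each word is added, so the bits of `c` name the path to a
leaf, and partial sums are shared between leaves. -/
lemma allTree_spec {q : ℕ → Bool} {ws : List ℕ} {acc : ℕ} (h : allTree q ws acc = true) (c : ℕ) :
    q (Nat.xor acc (combine ws c)) = true := by
  induction ws generalizing acc c with
  | nil =>
    have : Nat.xor acc (combine [] c) = acc := Nat.xor_zero acc
    rwa [this]
  | cons w ws ih =>
    rw [allTree, force_eq, Bool.and_eq_true] at h
    rw [combine]
    cases tb c 0
    · exact ih h.1 _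
    · have := ih h.2 (c / 2)
      rwa [show Nat.xor (Nat.xor acc w) (combine ws (c / 2)) =
        Nat.xor acc (Nat.xor w (combine ws (c / 2))) from Nat.xor_assoc _ _ _] at this

/-! ### Words as matrices of the trilinear form -/

lemma pair_eq_iff {n : ℕ} (j k p q : Fin n) :
    n * (p : ℕ) + q = n * (j : ℕ) + k ↔ p = j ∧ q = k := by
  have hn : 0 < n := j.pos
  constructor
  · intro h
    have h1 := congrArg (· / n) h
    have h2 := congrArg (· % n) h
    simp only [Nat.mul_add_div hn, Nat.div_eq_of_lt q.isLt, Nat.div_eq_of_lt k.isLt,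
      add_zero] at h1
    simp only [Nat.mul_add_mod, Nat.mod_eq_of_lt q.isLt, Nat.mod_eq_of_lt k.isLt] at h2
    exact ⟨Fin.ext h1, Fin.ext h2⟩
  · rintro ⟨rfl, rfl⟩
    rfl

lemma pair_lt {n : ℕ} (j k : Fin n) : n * (j : ℕ) + k < n * n := by
  have h1 : n * ((j : ℕ) + 1) ≤ n * n := Nat.mul_le_mul_left n j.isLt
  have := k.isLt
  rw [mul_add] at h1
  omega

lemma bitv_cond_beq (i p : ℕ) (m k : ℕ) :
    bitv (cond (Nat.beq p i) m 0) k = (if p = i then 1 else 0) * bitv m k := by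
  by_cases h : p = i
  · simp [h]
  · have : Nat.beq p i = false := by
      rw [← Bool.not_eq_true]
      exact fun h' => h (Nat.eq_of_beq_eq_true h')
    simp [h, this, bitv_zero]

lemma bitv_word_pair {n : ℕ} (l : List (Fin n × Fin n × Fin n)) (i j k : Fin n) :
    bitv (word n l i) (n * (j : ℕ) + k) =
      tri l (Pi.single i 1) (Pi.single j 1) (Pi.single k 1) := by
  induction l with
  | nil =>
    have := pair_lt j k
    rw [word, bitv_two_pow, if_neg (by omega)]
    rfl
  | cons t l ih =>
    simp only [word, tri, List.map_cons, List.sum_cons, bitv_xor, bitv_cond_beq, bitv_two_pow,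
      pair_eq_iff, Pi.single_apply] at ih ⊢
    rw [ih, add_comm]
    congr 1
    simp only [← Fin.ext_iff, ite_and, mul_ite, mul_one, mul_zero]
    rw [add_assoc]
    congr 1
    · split_ifs <;> rfl
    · congr 1 <;> split_ifs <;> rfl

/-- The block above position `n * n` records which basis words were added, so a sum of words carries
its vector along with its matrix. -/
lemma bitv_word_index {n : ℕ} (l : List (Fin n × Fin n × Fin n)) (i j : Fin n) :
    bitv (word n l i) (n * n + j) = if i = j then 1 else 0 := by
  induction l with
  | nil => simp [word, bitv_two_pow, Fin.ext_iff]
  | cons t l ih =>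
    have hne : ∀ p q : Fin n, n * (p : ℕ) + q ≠ n * n + j := fun p q => by
      have := pair_lt p q
      omega
    simp only [word, bitv_xor, bitv_cond_beq, bitv_two_pow, hne, if_false, ih, add_zero, mul_zero]

/-- The word `m` codes the vector `a` and the matrix of `tri l a`. -/
structure Codes {n : ℕ} (l : List (Fin n × Fin n × Fin n)) (a : Fin n → ZMod 2) (m : ℕ) :
    Prop where
  pair : ∀ j k : Fin n, bitv m (n * (j : ℕ) + k) = tri l a (Pi.single j 1) (Pi.single k 1)
  index : vec n (Nat.shiftRight m (n * n)) = a

/-- The words of the standard basis vectors. -/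
def words (n : ℕ) (l : List (Fin n × Fin n × Fin n)) : List ℕ := (List.range n).map (word n l)

lemma codes_combine {n : ℕ} (l : List (Fin n × Fin n × Fin n)) (c : ℕ) :
    Codes l (vec n c) (combine (words n l) c) where
  pair j k := by
    rw [words, bitv_combine_map, tri_eq_sum_left]
    exact Finset.sum_congr rfl fun i _ => by rw [bitv_word_pair]
  index := by
    ext j
    rw [vec, bitv_shiftRight, words, bitv_combine_map]
    simp [bitv_word_index]

lemma exists_codes_of_allTree {n : ℕ} {l : List (Fin n × Fin n × Fin n)} {q : ℕ → Bool}
    (h : allTree q (words n l) 0 = true) (a : Fin n → ZMod 2) :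
    ∃ m, Codes l a m ∧ q m = true := by
  obtain ⟨c, -, rfl⟩ := exists_vec_eq a
  refine ⟨_, codes_combine l c, ?_⟩
  have := allTree_spec h c
  rwa [show Nat.xor 0 (combine (words n l) c) = combine (words n l) c from Nat.zero_xor _] at this

namespace Codes

variable {n : ℕ} {l : List (Fin n × Fin n × Fin n)} {a : Fin n → ZMod 2} {m : ℕ}

lemma mod_eq_zero_iff (h : Codes l a m) :
    m % 2 ^ (n * n) = 0 ↔ ∀ b, b ∈ rad (cubicForm l) a := by
  rw [rad_cubicForm_eq_univ]
  constructor
  · intro hm j k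
    rw [← h.pair, bitv_eq_zero_of_mod hm (pair_lt j k)]
  · intro H
    refine mod_two_pow_eq_zero fun p hp => ?_
    have hn : 0 < n := by
      rcases Nat.eq_zero_or_pos n with rfl | hn
      · simp at hp
      · exact hn
    have := h.pair ⟨p / n, Nat.div_lt_of_lt_mul hp⟩ ⟨p % n, Nat.mod_lt _ hn⟩
    rwa [H, Nat.div_add_mod] at this

lemma bitv_row (h : Codes l a m) (j k : Fin n) :
    bitv (row n m j) k = tri l a (Pi.single j 1) (Pi.single k 1) := by
  rw [row, bitv_mod_two_pow, if_pos k.isLt, bitv_shiftRight, h.pair]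

lemma bitv_augRow (h : Codes l a m) (j k : Fin n) :
    bitv (Nat.xor (row n m j) (2 ^ (n + (j : ℕ)))) k =
      tri l a (Pi.single j 1) (Pi.single k 1) := by
  have := k.isLt
  rw [bitv_xor, h.bitv_row, bitv_two_pow, if_neg (by omega), add_zero]

lemma vec_augRow (j : Fin n) :
    vec n (Nat.shiftRight (Nat.xor (row n m j) (2 ^ (n + (j : ℕ)))) n) = Pi.single j 1 := by
  ext i
  rw [vec, bitv_shiftRight, bitv_xor, row, bitv_mod_two_pow, if_neg (by omega), zero_add,
    bitv_two_pow, Pi.single_apply]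
  simp [Fin.ext_iff, eq_comm]

end Codes

/-! ### Elimination -/

lemma clearBit_eq (k w : ℕ) (ws : List ℕ) :
    clearBit k w ws = ws.map fun v => cond (tb v k) (Nat.xor v w) v := by
  induction ws with
  | nil => rfl
  | cons v vs ih => rw [clearBit, force_eq, ih, List.map_cons]

lemma xor_cancel_right (v w : ℕ) : Nat.xor (Nat.xor v w) w = v := by
  change v ^^^ w ^^^ w = v
  rw [Nat.xor_assoc, Nat.xor_self, Nat.xor_zero]

lemma mem_span_cons {v w : ℕ} {ws : List ℕ} :
    v ∈ span (w :: ws) ↔ v ∈ span ws ∨ Nat.xor v w ∈ span ws := by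
  have hc : ∀ u, Nat.xor w u = Nat.xor u w := fun u => Nat.xor_comm w u
  simp only [span, List.mem_append, List.mem_map, hc]
  refine or_congr_right ⟨?_, fun h => ⟨_, h, xor_cancel_right v w⟩⟩
  rintro ⟨u, hu, rfl⟩
  rwa [xor_cancel_right]

lemma length_span (ws : List ℕ) : (span ws).length = 2 ^ ws.length := by
  induction ws with
  | nil => rfl
  | cons w ws ih => simp [span, ih, pow_succ, mul_two]

lemma combine_mem_span (ws : List ℕ) (c : ℕ) : combine ws c ∈ span ws := by
  induction ws generalizing c with
  | nil => simp [combine, span]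
  | cons w ws ih =>
    rw [combine, mem_span_cons]
    cases tb c 0
    · exact Or.inl (ih _)
    · refine Or.inr ?_
      rw [cond_true, show Nat.xor w (combine ws (c / 2)) = Nat.xor (combine ws (c / 2)) w from
        Nat.xor_comm _ _, xor_cancel_right]
      exact ih _

lemma tb_xor (v w k : ℕ) : tb (Nat.xor v w) k = xor (tb v k) (tb w k) := by
  simp only [tb_eq]
  exact Nat.testBit_xor v w k

/-- Adding `w` exactly when bit `k` is set is a linear map if `w` has bit `k`, and it then carries
the span into the span of the images. If `w` lacks bit `k`, the map is still additive, since adding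
`w` leaves that bit alone. -/
lemma mem_span_clearBit {k w : ℕ} {ws : List ℕ} {u : ℕ} (hu : u ∈ span ws) :
    cond (tb u k) (Nat.xor u w) u ∈ span (clearBit k w ws) := by
  rw [clearBit_eq]
  induction ws generalizing u with
  | nil =>
    simp only [span, List.mem_singleton] at hu
    subst hu
    have : tb 0 k = false := by simp [tb_eq]
    simp [this, span]
  | cons v vs ih =>
    rw [List.map_cons, mem_span_cons]
    have hswap : ∀ p q r, Nat.xor (Nat.xor p q) r = Nat.xor (Nat.xor p r) q := fun p q r =>
      Nat.xor_right_comm p q r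
    rcases mem_span_cons.mp hu with h | h
    · exact Or.inl (ih h)
    · have h' := ih h
      rw [tb_xor] at h'
      refine Or.inr ?_
      cases hu' : tb u k <;> cases hv : tb v k <;>
        simp only [hu', hv, Bool.xor_false, Bool.xor_true, Bool.not_true, Bool.not_false,
          cond_true, cond_false] at h' ⊢
      · exact h'
      · rwa [show Nat.xor u (Nat.xor v w) = Nat.xor (Nat.xor u v) w from
          (Nat.xor_assoc u v w).symm]
      · rwa [hswap]
      · rwa [show Nat.xor (Nat.xor u w) (Nat.xor v w) = Nat.xor (Nat.xor (Nat.xor u w) v) w from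
          (Nat.xor_assoc (Nat.xor u w) v w).symm, hswap u w v, xor_cancel_right]

/-- The pivot `w` is discarded. A vector with bit `k` unset is in the old span modulo `w`, and
clearing bit `k` of the representative returns that same vector. -/
lemma mem_span_elimBit {k : ℕ} {ws : List ℕ} {v : ℕ} (hv : v ∈ span ws) (hk : tb v k = false) :
    v ∈ span (elimBit k ws) := by
  induction ws generalizing v with
  | nil => exact hv
  | cons w ws ih =>
    rw [elimBit]
    cases hw : tb w k
    · rw [cond_false, mem_span_cons]
      rcases mem_span_cons.mp hv with h | h
      · exact Or.inl (ih h hk)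
      · exact Or.inr (ih h (by rw [tb_xor, hk, hw]; rfl))
    · rw [cond_true]
      rcases mem_span_cons.mp hv with h | h
      · have := mem_span_clearBit (k := k) (w := w) h
        rwa [hk] at this
      · have := mem_span_clearBit (k := k) (w := w) h
        rwa [tb_xor, hk, hw, Bool.false_xor, cond_true, xor_cancel_right] at this

lemma mem_span_elim {k : ℕ} {ws : List ℕ} {v : ℕ} (hv : v ∈ span ws)
    (hk : ∀ i < k, tb v i = false) : v ∈ span (elim k ws) := by
  induction k generalizing ws with
  | zero => exact hv
  | succ k ih =>
    exact ih (mem_span_elimBit hv (hk k k.lt_succ_self)) fun i hi => hk i (hi.trans k.lt_succ_self)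

/-- Elimination only adds rows to each other, so closed conditions persist. This gives soundness;
`mem_span_elim` gives completeness. -/
lemma forall_elimBit {P : ℕ → Prop} (hP : ∀ u v, P u → P v → P (Nat.xor u v)) {k : ℕ}
    {ws : List ℕ} (h : ∀ w ∈ ws, P w) : ∀ w ∈ elimBit k ws, P w := by
  induction ws with
  | nil => exact h
  | cons w ws ih =>
    have h1 := h w List.mem_cons_self
    have h2 : ∀ v ∈ ws, P v := fun v hv => h v (List.mem_cons_of_mem _ hv)
    rw [elimBit]
    cases tb w k
    · rw [cond_false]
      intro v hv
      rcases List.mem_cons.mp hv with rfl | hv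
      · exact h1
      · exact ih h2 v hv
    · rw [cond_true, clearBit_eq]
      intro v hv
      obtain ⟨u, hu, rfl⟩ := List.mem_map.mp hv
      cases tb u k
      · exact h2 u hu
      · exact hP _ _ (h2 u hu) h1

lemma forall_elim {P : ℕ → Prop} (hP : ∀ u v, P u → P v → P (Nat.xor u v)) {k : ℕ}
    {ws : List ℕ} (h : ∀ w ∈ ws, P w) : ∀ w ∈ elim k ws, P w := by
  induction k generalizing ws with
  | zero => exact h
  | succ k ih => exact ih (forall_elimBit hP h)

lemma shiftRight_xor (u v n : ℕ) :
    Nat.shiftRight (Nat.xor u v) n = Nat.xor (Nat.shiftRight u n) (Nat.shiftRight v n) :=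
  Nat.shiftRight_xor_distrib

namespace Codes

variable {n : ℕ} {l : List (Fin n × Fin n × Fin n)} {a : Fin n → ZMod 2} {m : ℕ}

/-- Elimination preserves the invariant that the low `n` bits are the image under the matrix of the
vector in the high bits. A zero low part therefore exhibits a kernel vector. -/
lemma mem_rad_of_mem_elim (h : Codes l a m) {w : ℕ} (hw : w ∈ elim n (augRows n m))
    (h0 : w % 2 ^ n = 0) : vec n (Nat.shiftRight w n) ∈ rad (cubicForm l) a := by
  have key : ∀ w ∈ elim n (augRows n m), ∀ k : Fin n,
      bitv w k = tri l a (vec n (Nat.shiftRight w n)) (Pi.single k 1) := by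
    refine forall_elim (fun u v hu hv k => ?_) fun w hw k => ?_
    · rw [bitv_xor, hu, hv, shiftRight_xor, vec_xor, tri_add_mid]
    · obtain ⟨j, hj, rfl⟩ := List.mem_map.mp hw
      have hj := List.mem_range.mp hj
      have h1 := h.bitv_augRow ⟨j, hj⟩ k
      have h2 := vec_augRow (m := m) (⟨j, hj⟩ : Fin n)
      simp only at h1 h2
      rw [h1, h2]
  rw [mem_rad_cubicForm]
  intro k
  rw [← key w hw, bitv_eq_zero_of_mod h0 k.isLt]

/-- A kernel vector yields a sum of augmented rows with zero low part, and such a sum survives the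
elimination of all low bits. -/
lemma exists_mem_span_elim (h : Codes l a m) {b : Fin n → ZMod 2}
    (hb : b ∈ rad (cubicForm l) a) :
    ∃ w ∈ span (elim n (augRows n m)), vec n (Nat.shiftRight w n) = b := by
  obtain ⟨c, -, rfl⟩ := exists_vec_eq b
  refine ⟨combine (augRows n m) c, mem_span_elim (combine_mem_span _ _) fun k hk => ?_, ?_⟩
  · have h1 : bitv (combine (augRows n m) c) k = 0 := by
      rw [augRows, bitv_combine_map, ← tri_eq_zero_of_mem_rad hb (Pi.single ⟨k, hk⟩ 1),
        tri_eq_sum_mid]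
      exact Finset.sum_congr rfl fun i _ => by rw [← h.bitv_augRow i ⟨k, hk⟩]
    rw [tb_eq]
    exact bz_injective h1
  · ext i
    rw [vec, bitv_shiftRight, augRows, bitv_combine_map]
    have h2 : ∀ j : Fin n, bitv (Nat.xor (row n m j) (2 ^ (n + (j : ℕ)))) (n + i) =
        if i = j then 1 else 0 := fun j => by
      have := congrFun (vec_augRow (m := m) j) i
      rwa [vec, bitv_shiftRight, Pi.single_apply] at this
    simp only [h2]
    simp

lemma ncard_rad_le (h : Codes l a m) :
    (rad (cubicForm l) a).ncard ≤ 2 ^ (elim n (augRows n m)).length := by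
  classical
  have hsub : rad (cubicForm l) a ⊆
      (((span (elim n (augRows n m))).map fun w => vec n (Nat.shiftRight w n)).toFinset :
        Set (Fin n → ZMod 2)) := fun b hb => by
    obtain ⟨w, hw, rfl⟩ := h.exists_mem_span_elim hb
    simpa using ⟨w, hw, rfl⟩
  refine (Set.ncard_le_ncard hsub (Finset.finite_toSet _)).trans ?_
  rw [Set.ncard_coe_finset, ← length_span]
  exact (List.toFinset_card_le _).trans_eq (List.length_map _)

end Codes

/-! ### Truth tables -/

lemma coordTable_lt (n i : ℕ) : coordTable n i < 2 ^ 2 ^ n := by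
  induction n with
  | zero => simp [coordTable]
  | succ n ih =>
    have h2 : 2 ^ (n + 1) = 2 ^ n + 2 ^ n := by rw [pow_succ, mul_two]
    have h1 : cond (Nat.beq n i) (2 ^ 2 ^ n - 1) (coordTable n i) < 2 ^ 2 ^ n := by
      cases Nat.beq n i
      · exact ih
      · exact Nat.sub_lt (by positivity) one_pos
    rw [coordTable]
    refine Nat.or_lt_two_pow (ih.trans_le (Nat.pow_le_pow_right two_pos
      (Nat.pow_le_pow_right two_pos n.le_succ))) ?_
    rw [show Nat.shiftLeft (cond (Nat.beq n i) (2 ^ 2 ^ n - 1) (coordTable n i)) (2 ^ n) =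
      cond (Nat.beq n i) (2 ^ 2 ^ n - 1) (coordTable n i) * 2 ^ 2 ^ n from Nat.shiftLeft_eq _ _,
      h2, pow_add 2 (2 ^ n)]
    exact Nat.mul_lt_mul_of_pos_right h1 (by positivity)

/-- Passing from `n` to `n + 1` variables doubles the table: its upper half copies the lower one,
except that it is all ones for the new top variable. -/
lemma testBit_coordTable (n i c : ℕ) (hc : c < 2 ^ n) :
    (coordTable n i).testBit c = c.testBit i := by
  induction n generalizing c with
  | zero =>
    obtain rfl : c = 0 := by simpa using hc
    simp [coordTable]
  | succ n ih =>
    have e : (coordTable (n + 1) i).testBit c = ((coordTable n i).testBit c ||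
        (decide (2 ^ n ≤ c) &&
          (cond (Nat.beq n i) (2 ^ 2 ^ n - 1) (coordTable n i)).testBit (c - 2 ^ n))) := by
      rw [coordTable]
      exact (Nat.testBit_or _ _ _).trans (congrArg _ (Nat.testBit_shiftLeft _))
    rw [e]
    by_cases h : c < 2 ^ n
    · simp [ih c h, not_le.mpr h]
    · obtain ⟨d, rfl⟩ := Nat.exists_eq_add_of_le (not_lt.mp h)
      have hd : d < 2 ^ n := by
        rw [pow_succ] at hc
        omega
      rw [Nat.testBit_lt_two_pow ((coordTable_lt n i).trans_le
        (Nat.pow_le_pow_right two_pos (Nat.le_add_right _ _))), Nat.add_sub_cancel_left]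
      simp only [Nat.le_add_right, decide_true, Bool.true_and, Bool.false_or]
      by_cases hi : n = i
      · subst hi
        have : Nat.beq n n = true := Nat.beq_refl n
        rw [this, cond_true, Nat.testBit_two_pow_sub_one, Nat.testBit_two_pow_add_eq,
          Nat.testBit_lt_two_pow hd]
        simpa using hd
      · have : Nat.beq n i = false := by
          rw [← Bool.not_eq_true]
          exact fun h' => hi (Nat.eq_of_beq_eq_true h')
        rw [this, cond_false, ih d hd]
        rcases lt_or_gt_of_ne hi with h1 | h1
        · have h2 : 2 ^ (n + 1) ≤ 2 ^ i := Nat.pow_le_pow_right two_pos h1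
          rw [Nat.testBit_lt_two_pow (by omega),
            Nat.testBit_lt_two_pow (by rw [pow_succ] at h2; omega)]
        · rw [Nat.testBit_two_pow_add_gt h1]

lemma bitv_table {n : ℕ} (l : List (Fin n × Fin n × Fin n)) {c : ℕ} (hc : c < 2 ^ n) :
    bitv (table n l) c = cubicForm l (vec n c) := by
  induction l with
  | nil => simp [table, cubicForm, bitv_zero]
  | cons t l ih =>
    have hand : ∀ p q, bitv (Nat.land p q) c = bitv p c * bitv q c := fun p q => by
      have : (Nat.land p q).testBit c = (p.testBit c && q.testBit c) := Nat.testBit_and p q c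
      rw [bitv, this, bz_and]
      rfl
    have hX : ∀ i : Fin n, bitv (coordTable n i) c = vec n c i := fun i => by
      rw [bitv, testBit_coordTable n i c hc]
      rfl
    rw [table, bitv_xor, ih, hand, hand, hX, hX, hX]
    simp only [cubicForm, List.map_cons, List.sum_cons]
    ring

lemma bz_look {n : ℕ} (l : List (Fin n × Fin n × Fin n)) (c : ℕ) :
    bz (look n (table n l) c) = cubicForm l (vec n c) := by
  rw [look, tb_eq, ← vec_mod, ← bitv_table l (Nat.mod_lt _ (by positivity))]
  rfl

lemma bz_look2 {n : ℕ} (l : List (Fin n × Fin n × Fin n)) (a b x : ℕ) :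
    bz (look2 n (table n l) a b x) =
      deriv2 (cubicForm l) (vec n a) (vec n b) (vec n x) := by
  simp only [look2, bz_xor, bz_look, vec_xor, deriv2]
  ring

/-- An affine function of `x` vanishes once it does so at 0 and at the standard basis vectors. -/
lemma deriv2_eq_zero_of_look2 {n : ℕ} {l : List (Fin n × Fin n × Fin n)} {a b : ℕ}
    (h0 : look2 n (table n l) a b 0 = false)
    (h : ∀ k < n, look2 n (table n l) a b (2 ^ k) = false) (x : Fin n → ZMod 2) :
    deriv2 (cubicForm l) (vec n a) (vec n b) x = 0 := by
  have e0 : deriv2 (cubicForm l) (vec n a) (vec n b) 0 = 0 := by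
    rw [← vec_zero, ← bz_look2, h0]
    rfl
  rw [deriv2_cubicForm, e0, zero_add, tri_eq_sum_right]
  refine Finset.sum_eq_zero fun k _ => ?_
  have h1 := deriv2_cubicForm l (vec n a) (vec n b) (Pi.single k 1)
  rw [← vec_two_pow, ← bz_look2, h k k.isLt, e0, zero_add, vec_two_pow] at h1
  rw [← h1]
  exact mul_zero _

/-! ### Checking bentness and the Maiorana-McFarland property -/

/-- For the vector `a` coded by `m`, looks for `b` such that the second derivative in the
directions `a`, `b` is the constant `1`. -/
def bentLeaf (n F m : ℕ) : Bool :=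
  force (Nat.shiftRight m (n * n)) fun a => Nat.beq a 0 ||
    (elim n (augRows n m)).any fun w =>
      Nat.beq (w % 2 ^ n) 0 && look2 n F a (Nat.shiftRight w n) 0

/-- Checks `q F` on the words of all vectors, where `F` is the truth table of `cubicForm l`. -/
def checkAll (n : ℕ) (q : ℕ → ℕ → Bool) (l : List (Fin n × Fin n × Fin n)) : Bool :=
  force (table n l) fun F => forceMap (word n l) (List.range n) fun ws => allTree (q F) ws 0

lemma exists_codes_of_checkAll {n : ℕ} {q : ℕ → ℕ → Bool} {l : List (Fin n × Fin n × Fin n)}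
    (h : checkAll n q l = true) (a : Fin n → ZMod 2) :
    ∃ m, Codes l a m ∧ q (table n l) m = true := by
  rw [checkAll, force_eq, forceMap_eq] at h
  exact exists_codes_of_allTree h a

/-- For `b` in the kernel the second derivative is constant, so one value at 0 decides it. That
value is additive in `b` on the kernel, so testing a spanning set loses nothing. -/
lemma isBent_of_checkAll {n : ℕ} (l : List (Fin n × Fin n × Fin n))
    (h : checkAll n (bentLeaf n) l = true) : IsBent (cubicForm l) := by
  refine isBent_of_deriv2_eq_one fun a ha => ?_
  obtain ⟨m, hm, hq⟩ := exists_codes_of_checkAll h a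
  rw [bentLeaf, force_eq, Bool.or_eq_true, List.any_eq_true] at hq
  rcases hq with h0 | ⟨w, hw, hw'⟩
  · have hi := hm.index
    rw [Nat.eq_of_beq_eq_true h0, vec_zero] at hi
    exact absurd hi.symm ha
  · rw [Bool.and_eq_true] at hw'
    have hr := hm.mem_rad_of_mem_elim hw (Nat.eq_of_beq_eq_true hw'.1)
    refine ⟨_, fun x => (hr x).trans ?_⟩
    rw [← hm.index, ← vec_zero, ← bz_look2, hw'.2]
    rfl

/-- For the vector `a` coded by `m`: either the code of `a` belongs to `W`, or there are fewer than
`d` directions `b` with vanishing second derivative in the directions `a`, `b`, or there are at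
most `d` of them and some second derivative in two of these directions does not vanish. -/
def isotropicLeaf (n d : ℕ) (W : List ℕ) (F m : ℕ) : Bool :=
  force (Nat.shiftRight m (n * n)) fun a => W.any (Nat.beq a) ||
    forceMap id (elim n (augRows n m)) fun S => Nat.blt (2 ^ S.length) d ||
      forceMap id (((span S).map fun w => Nat.shiftRight w n).filter fun b => !look2 n F a b 0)
        fun N => Nat.blt N.length d || (Nat.ble N.length d && N.any fun b => N.any fun c =>
          look2 n F b c 0 || (List.range n).any fun k => look2 n F b c (2 ^ k))

/-- Let `U` be the set of `2 ^ m` directions forced by membership. For `a` in `U`, all of `U` lies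
in the set `N` of directions isotropic to `a`. So `N` cannot be smaller than `2 ^ m`, and if it is
no larger, then `U = N` and `N` itself must be isotropic. Only directions from `W` escape both
tests, and they are too few to fill `U`. -/
lemma not_mem_completedMM_of_checkAll {m : ℕ} (l : List (Fin (m + m) × Fin (m + m) × Fin (m + m)))
    (W : List ℕ) (hW : W.length < 2 ^ m)
    (h : checkAll (m + m) (isotropicLeaf (m + m) (2 ^ m) W) l = true) :
    cubicForm l ∉ completedMM m := by
  classical
  intro hmem
  obtain ⟨U, hU, hiso⟩ := exists_isotropic_of_mem_completedMM hmem
  have hsub : U ⊆ (W.map (vec (m + m))).toFinset := by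
    intro a ha
    obtain ⟨w, hw, hq⟩ := exists_codes_of_checkAll h a
    rw [isotropicLeaf, force_eq, Bool.or_eq_true, List.any_eq_true, forceMap_eq, List.map_id,
      Bool.or_eq_true, forceMap_eq, List.map_id] at hq
    rcases hq with ⟨c, hc, hc'⟩ | hq
    · rw [List.mem_toFinset, List.mem_map]
      exact ⟨c, hc, by rw [← Nat.eq_of_beq_eq_true hc', hw.index]⟩
    · exfalso
      set N := ((span (elim (m + m) (augRows (m + m) w))).map
        fun v => Nat.shiftRight v (m + m)).filter fun b =>
          !look2 (m + m) (table (m + m) l) (Nat.shiftRight w ((m + m) * (m + m))) b 0 with hN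
      have hUN : U ⊆ (N.map (vec (m + m))).toFinset := by
        intro b hb
        have hz := hiso a ha b hb
        -- A vanishing second derivative is in particular constant, so `b` is in the kernel and
        -- hence among the enumerated vectors.
        obtain ⟨v, hv, rfl⟩ := hw.exists_mem_span_elim (b := b) fun x => by rw [hz, hz]
        rw [List.mem_toFinset, List.mem_map]
        refine ⟨_, List.mem_filter.mpr ⟨List.mem_map.mpr ⟨v, hv, rfl⟩, ?_⟩, rfl⟩
        have h1 := bz_look2 l (Nat.shiftRight w ((m + m) * (m + m)))
          (Nat.shiftRight v (m + m)) 0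
        rw [hw.index, hz, show (0 : ZMod 2) = bz false from rfl] at h1
        rw [bz_injective h1]
        rfl
      have hle : (N.map (vec (m + m))).toFinset.card ≤ N.length :=
        (List.toFinset_card_le _).trans_eq (List.length_map _)
      have hcard := Finset.card_le_card hUN
      have hspan : N.length ≤ 2 ^ (elim (m + m) (augRows (m + m) w)).length :=
        (List.length_filter_le _ _).trans_eq ((List.length_map _).trans (length_span _))
      rw [Bool.or_eq_true, Bool.and_eq_true] at hq
      rcases hq with hlt | hlt | ⟨hd, hq⟩
      · have := Nat.blt_eq.mp hlt
        omega
      · have := Nat.blt_eq.mp hlt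
        omega
      · have hd := Nat.ble_eq.mp hd
        have hUeq : U = (N.map (vec (m + m))).toFinset :=
          Finset.eq_of_subset_of_card_le hUN (by omega)
        simp only [List.any_eq_true, Bool.or_eq_true] at hq
        obtain ⟨b, hb, c, hc, hq⟩ := hq
        have hmem : ∀ b ∈ N, vec (m + m) b ∈ U := fun b hb => by
          rw [hUeq, List.mem_toFinset]
          exact List.mem_map_of_mem hb
        have hz := hiso _ (hmem b hb) _ (hmem c hc)
        have hx : ∀ x, look2 (m + m) (table (m + m) l) b c x = true → False := fun x hx => by
          have := bz_look2 l b c x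
          rw [hz, hx] at this
          exact one_ne_zero this
        rcases hq with hq | ⟨k, -, hq⟩ <;> exact hx _ hq
  have h1 := Finset.card_le_card hsub
  have h2 := (W.map (vec (m + m))).toFinset_card_le
  rw [List.length_map] at h2
  omega

/-! ### Membership in `ℳ^#` from an explicit basis -/

/-- The code of the vector of first derivatives at `w` in the directions `us`. -/
def derivCode (n F w : ℕ) : List ℕ → ℕ
  | [] => 0
  | u :: us => Nat.bit (xor (look n F (Nat.xor w u)) (look n F w)) (derivCode n F w us)

lemma bitv_derivCode {n : ℕ} (l : List (Fin n × Fin n × Fin n)) (w : ℕ) (us : List ℕ) (i : ℕ)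
    (hi : i < us.length) : bitv (derivCode n (table n l) w us) i =
      derivative (vec n (us.getD i 0)) (cubicForm l) (vec n w) := by
  induction us generalizing i with
  | nil => simp at hi
  | cons u us ih =>
    cases i with
    | zero =>
      rw [derivCode, bitv, Nat.testBit_bit_zero, bz_xor, bz_look, bz_look, vec_xor]
      rfl
    | succ i =>
      rw [derivCode, bitv, Nat.testBit_bit_succ, List.getD_cons_succ,
        ← ih i (Nat.lt_of_succ_lt_succ hi)]
      rfl

/-- Checks that `us ++ vs` is a basis, as witnessed by the inverse basis change `cs`, that the
second derivatives in the directions `us` vanish, and that the derivatives in the directions `us`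
permute the span of `vs`. -/
def mmCheck (m : ℕ) (us vs cs : List ℕ) (l : List (Fin (m + m) × Fin (m + m) × Fin (m + m))) :
    Bool :=
  force (table (m + m) l) fun F =>
    Nat.beq us.length m && Nat.beq vs.length m &&
    (List.range (m + m)).all (fun k => Nat.beq (combine (us ++ vs) (cs.getD k 0)) (2 ^ k)) &&
    us.all (fun u => us.all fun u' => !look2 (m + m) F u u' 0 &&
      (List.range (m + m)).all fun k => !look2 (m + m) F u u' (2 ^ k)) &&
    forceMap (fun y => derivCode (m + m) F (combine vs y) us) (List.range (2 ^ m)) fun L =>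
      (List.range (2 ^ m)).all fun t => L.any (Nat.beq t)

lemma vec_combine {n m : ℕ} {ws : List ℕ} (hws : ws.length = m) (c : ℕ) :
    vec n (combine ws c) = ∑ i : Fin m, vec m c i • vec n (ws.getD i 0) := by
  subst hws
  ext p
  rw [vec, bitv_combine, Finset.sum_range, Finset.sum_apply]
  rfl

lemma mem_completedMM_of_mmCheck {m : ℕ} (us vs cs : List ℕ)
    (l : List (Fin (m + m) × Fin (m + m) × Fin (m + m))) (h : mmCheck m us vs cs l = true) :
    cubicForm l ∈ completedMM m := by
  rw [mmCheck, force_eq, forceMap_eq] at h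
  simp only [Bool.and_eq_true] at h
  obtain ⟨⟨⟨⟨hus, hvs⟩, hspan⟩, hiso⟩, hperm⟩ := h
  have hus := Nat.eq_of_beq_eq_true hus
  have hvs := Nat.eq_of_beq_eq_true hvs
  refine mem_completedMM_of_isotropic _ (fun i => vec _ (us.getD i 0))
    (fun i => vec _ (vs.getD i 0)) (fun k => ?_) (fun i j x => ?_) fun t => ?_
  · have h1 := Nat.eq_of_beq_eq_true
      (List.all_eq_true.mp hspan k (List.mem_range.mpr k.isLt))
    refine ⟨vec _ (cs.getD k 0), ?_⟩
    rw [← vec_two_pow, ← h1, vec_combine (m := m + m) (by simp [hus, hvs]), Fin.sum_univ_add]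
    congr 1 <;> refine Finset.sum_congr rfl fun i _ => ?_
    · rw [Fin.val_castAdd, List.getD_append _ _ _ _ (by rw [hus]; exact i.isLt)]
    · rw [Fin.val_natAdd, List.getD_append_right _ _ _ _ (by rw [hus]; omega), hus,
        Nat.add_sub_cancel_left]
  · have hmem : ∀ i : Fin m, us.getD i 0 ∈ us := fun i => by
      rw [List.getD_eq_getElem _ _ (by rw [hus]; exact i.isLt)]
      exact List.getElem_mem _
    have h1 := List.all_eq_true.mp (List.all_eq_true.mp hiso _ (hmem i)) _ (hmem j)
    rw [Bool.and_eq_true, Bool.not_eq_true', List.all_eq_true] at h1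
    exact deriv2_eq_zero_of_look2 h1.1 (fun k hk => by
      simpa using h1.2 k (List.mem_range.mpr hk)) x
  · obtain ⟨c, hc, rfl⟩ := exists_vec_eq t
    obtain ⟨p, hp, hp'⟩ := List.any_eq_true.mp
      (List.all_eq_true.mp hperm c (List.mem_range.mpr hc))
    obtain ⟨y, -, rfl⟩ := List.mem_map.mp hp
    refine ⟨vec m y, ?_⟩
    ext i
    beta_reduce
    rw [← vec_combine hvs, ← bitv_derivCode l _ us i (by rw [hus]; exact i.isLt),
      ← Nat.eq_of_beq_eq_true hp']
    rfl

/-! ### Invariants of equivalence -/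

/-- All second derivatives of `f` in the direction `a` and another direction are constant. -/
def InRadical {n : ℕ} (f : BoolFun n) (a : Fin n → ZMod 2) : Prop := ∀ b, b ∈ rad f a

/-- The radical of `f` contains at least `k` elements. -/
def RadicalCardGE {n : ℕ} (k : ℕ) (f : BoolFun n) : Prop := k ≤ {a | InRadical f a}.ncard

/-- Some direction has a radical with at most `k` elements. -/
def HasSmallRad {n : ℕ} (k : ℕ) (f : BoolFun n) : Prop := ∃ a, (rad f a).ncard ≤ k

/-- For some direction `a` outside the radical, any three vectors are dependent modulo `rad f a`. -/
def HasRankTwo {n : ℕ} (f : BoolFun n) : Prop :=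
  ∃ a, ¬ InRadical f a ∧ ∀ c₁ c₂ c₃, ∃ s : Fin 3 → ZMod 2, s ≠ 0 ∧
    s 0 • c₁ + s 1 • c₂ + s 2 • c₃ ∈ rad f a

/-- For some direction `a` outside the radical, `rad f a` determines `a` modulo the radical. -/
def HasRigidRad {n : ℕ} (f : BoolFun n) : Prop :=
  ∃ a, ¬ InRadical f a ∧ ∀ b, rad f a ⊆ rad f b → InRadical f b ∨ InRadical f (a + b)

section Invariance

variable {n : ℕ} {f f' : BoolFun n}

lemma inRadical_iff {L : (Fin n → ZMod 2) ≃ₗ[ZMod 2] (Fin n → ZMod 2)}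
    (hL : ∀ a b, b ∈ rad f' a ↔ L b ∈ rad f (L a)) (a : Fin n → ZMod 2) :
    InRadical f' a ↔ InRadical f (L a) := by
  constructor
  · intro h b
    have := (hL a (L.symm b)).mp (h _)
    rwa [L.apply_symm_apply] at this
  · exact fun h b => (hL a b).mpr (h _)

lemma Equivalent.radicalCardGE {k : ℕ} (h : Equivalent f f') (h' : RadicalCardGE k f') :
    RadicalCardGE k f := by
  obtain ⟨L, hL⟩ := h.exists_rad
  refine h'.trans (Set.ncard_le_ncard_of_injOn L (fun a ha => ?_) L.injective.injOn)
  exact (inRadical_iff hL a).mp ha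

lemma Equivalent.hasSmallRad {k : ℕ} (h : Equivalent f f') (h' : HasSmallRad k f) :
    HasSmallRad k f' := by
  obtain ⟨L, hL⟩ := h.exists_rad
  obtain ⟨a, ha⟩ := h'
  refine ⟨L.symm a, (Set.ncard_le_ncard_of_injOn L (fun b hb => ?_) L.injective.injOn).trans ha⟩
  have := (hL _ _).mp hb
  rwa [L.apply_symm_apply] at this

/-- Dependence of any three vectors says that the kernel has codimension at most two; in this form
it passes directly through a linear bijection. -/
lemma Equivalent.hasRankTwo (h : Equivalent f f') (h' : HasRankTwo f') : HasRankTwo f := by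
  obtain ⟨L, hL⟩ := h.exists_rad
  obtain ⟨a, ha, H⟩ := h'
  refine ⟨L a, fun h => ha ((inRadical_iff hL a).mpr h), fun c₁ c₂ c₃ => ?_⟩
  obtain ⟨s, hs, h⟩ := H (L.symm c₁) (L.symm c₂) (L.symm c₃)
  refine ⟨s, hs, ?_⟩
  have := (hL _ _).mp h
  simpa only [map_add, map_smul, L.apply_symm_apply] using this

lemma Equivalent.hasRigidRad (h : Equivalent f f') (h' : HasRigidRad f') : HasRigidRad f := by
  obtain ⟨L, hL⟩ := h.exists_rad
  obtain ⟨a, ha, H⟩ := h'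
  refine ⟨L a, fun h => ha ((inRadical_iff hL a).mpr h), fun b hb => ?_⟩
  have h1 := H (L.symm b) fun c hc => by
    rw [hL, L.apply_symm_apply]
    exact hb ((hL _ _).mp hc)
  rwa [inRadical_iff hL, inRadical_iff hL, map_add, L.apply_symm_apply] at h1

end Invariance

/-! ### Checking the invariants -/

section Checks

variable {n : ℕ} (l : List (Fin n × Fin n × Fin n))

/-- Checks that the word `m` has a nonzero matrix or codes a member of `R`. -/
def radicalLeaf (n : ℕ) (R : List ℕ) (_F m : ℕ) : Bool :=
  !(Nat.beq (m % 2 ^ (n * n)) 0) || R.any (Nat.beq (Nat.shiftRight m (n * n)))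

lemma not_radicalCardGE_of_checkAll (R : List ℕ) {k : ℕ} (hk : R.length < k)
    (h : checkAll n (radicalLeaf n R) l = true) : ¬ RadicalCardGE k (cubicForm l) := by
  classical
  rw [RadicalCardGE, not_le]
  have hsub : {a | InRadical (cubicForm l) a} ⊆
      ((R.map (vec n)).toFinset : Set (Fin n → ZMod 2)) := fun a ha => by
    obtain ⟨m, hm, hq⟩ := exists_codes_of_checkAll h a
    rw [radicalLeaf, hm.mod_eq_zero_iff.mpr ha, Nat.beq_refl, Bool.not_true, Bool.false_or,
      List.any_eq_true] at hq
    obtain ⟨c, hc, hc'⟩ := hq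
    simp only [List.coe_toFinset, List.mem_map, Set.mem_ofPred_eq]
    exact ⟨c, hc, by rw [← Nat.eq_of_beq_eq_true hc', hm.index]⟩
  refine (Set.ncard_le_ncard hsub (Finset.finite_toSet _)).trans_lt ?_
  rw [Set.ncard_coe_finset]
  exact ((List.toFinset_card_le _).trans_eq (List.length_map _)).trans_lt hk

/-- Checks that all members of `R` code vectors in the radical. -/
def radicalCheck (n : ℕ) (R : List ℕ) (l : List (Fin n × Fin n × Fin n)) : Bool :=
  forceMap (word n l) (List.range n) fun ws =>
    R.all fun r => Nat.blt r (2 ^ n) && Nat.beq (combine ws r % 2 ^ (n * n)) 0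

lemma radicalCardGE_of_radicalCheck (R : List ℕ) (hR : R.Nodup)
    (h : radicalCheck n R l = true) : RadicalCardGE R.length (cubicForm l) := by
  classical
  rw [radicalCheck, forceMap_eq, List.all_eq_true] at h
  have h' : ∀ r ∈ R, r < 2 ^ n ∧ InRadical (cubicForm l) (vec n r) := fun r hr => by
    have := h r hr
    rw [Bool.and_eq_true] at this
    exact ⟨Nat.blt_eq.mp this.1,
      (codes_combine l r).mod_eq_zero_iff.mp (Nat.eq_of_beq_eq_true this.2)⟩
  have hnd : (R.map (vec n)).Nodup :=
    hR.map_on fun x hx y hy hxy => vec_injOn (h' x hx).1 (h' y hy).1 hxy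
  rw [RadicalCardGE, ← List.length_map (f := vec n), ← List.toFinset_card_of_nodup hnd,
    ← Set.ncard_coe_finset]
  refine Set.ncard_le_ncard (fun a ha => ?_) (Set.toFinite _)
  simp only [List.coe_toFinset, List.mem_map, Set.mem_ofPred_eq] at ha
  obtain ⟨r, hr, rfl⟩ := ha
  exact (h' r hr).2

/-- Checks that the kernel of the matrix of the vector with code `c` has dimension at most `k`. -/
def smallRadCheck (n k c : ℕ) (l : List (Fin n × Fin n × Fin n)) : Bool :=
  forceMap (word n l) (List.range n) fun ws => force (combine ws c) fun m =>
    Nat.ble (elim n (augRows n m)).length k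

lemma hasSmallRad_of_smallRadCheck (k c : ℕ) (h : smallRadCheck n k c l = true) :
    HasSmallRad (2 ^ k) (cubicForm l) := by
  rw [smallRadCheck, forceMap_eq, force_eq] at h
  exact ⟨vec n c, (codes_combine l c).ncard_rad_le.trans
    (Nat.pow_le_pow_right two_pos (Nat.ble_eq.mp h))⟩

/-- Checks that a list of numbers has no repetitions. -/
def nodupCheck : List ℕ → Bool
  | [] => true
  | c :: cs => cs.all (fun d => !(Nat.beq c d)) && nodupCheck cs

lemma nodup_of_nodupCheck {cs : List ℕ} (h : nodupCheck cs = true) : cs.Nodup := by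
  induction cs with
  | nil => exact List.nodup_nil
  | cons c cs ih =>
    rw [nodupCheck, Bool.and_eq_true, List.all_eq_true] at h
    refine List.nodup_cons.mpr ⟨fun hc => ?_, ih h.2⟩
    have := h.1 c hc
    rw [Nat.beq_refl] at this
    exact Bool.false_ne_true this

/-- Checks that the kernel of the matrix coded by `m` has more than `k` elements, among them zero
and a basis. -/
def largeRadLeaf (n k : ℕ) (_F m : ℕ) : Bool :=
  forceMap id (elim n (augRows n m)) fun S =>
    Nat.ble k S.length && nodupCheck (0 :: S) &&
      S.all fun w => Nat.beq (w % 2 ^ n) 0 && Nat.blt (Nat.shiftRight w n) (2 ^ n)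

/-- Zero and `k` distinct nonzero kernel vectors already exceed `k`, without any appeal to
independence. For `n = 10` and `k = 4` this is no loss: alternating matrices have even rank, so a
kernel with more than 4 elements has dimension at least 4. -/
lemma not_hasSmallRad_of_checkAll (k : ℕ) (h : checkAll n (largeRadLeaf n k) l = true) :
    ¬ HasSmallRad k (cubicForm l) := by
  classical
  rintro ⟨a, ha⟩
  obtain ⟨m, hm, hq⟩ := exists_codes_of_checkAll h a
  rw [largeRadLeaf, forceMap_eq, List.map_id] at hq
  simp only [Bool.and_eq_true, List.all_eq_true] at hq
  obtain ⟨⟨hk, hnd⟩, hS⟩ := hq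
  set S := elim n (augRows n m)
  have hS' : ∀ w ∈ 0 :: S, w % 2 ^ n = 0 ∧ Nat.shiftRight w n < 2 ^ n ∧
      vec n (Nat.shiftRight w n) ∈ rad (cubicForm l) a := by
    intro w hw
    rcases List.mem_cons.mp hw with rfl | hw
    · have h0 : Nat.shiftRight 0 n = 0 := Nat.zero_shiftRight n
      rw [h0]
      refine ⟨Nat.zero_mod _, by positivity, ?_⟩
      rw [vec_zero, mem_rad_cubicForm]
      intro k
      rw [tri_eq_sum_mid]
      simp
    · have h1 := Nat.eq_of_beq_eq_true (hS w hw).1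
      exact ⟨h1, Nat.blt_eq.mp (hS w hw).2, hm.mem_rad_of_mem_elim hw h1⟩
  have hnd' : ((0 :: S).map fun w => vec n (Nat.shiftRight w n)).Nodup := by
    refine (nodup_of_nodupCheck hnd).map_on fun x hx y hy hxy => ?_
    have h1 := vec_injOn (hS' x hx).2.1 (hS' y hy).2.1 hxy
    have e : ∀ x, Nat.shiftRight x n = x / 2 ^ n := fun x => Nat.shiftRight_eq_div_pow x n
    rw [e, e] at h1
    rw [← Nat.div_add_mod x (2 ^ n), ← Nat.div_add_mod y (2 ^ n), h1, (hS' x hx).1, (hS' y hy).1]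
  have hle : ((0 :: S).map fun w => vec n (Nat.shiftRight w n)).toFinset.card ≤
      (rad (cubicForm l) a).ncard := by
    rw [← Set.ncard_coe_finset]
    refine Set.ncard_le_ncard (fun b hb => ?_) (Set.toFinite _)
    simp only [List.coe_toFinset, List.mem_map, Set.mem_ofPred_eq] at hb
    obtain ⟨w, hw, rfl⟩ := hb
    exact (hS' w hw).2.2
  rw [List.toFinset_card_of_nodup hnd', List.length_map, List.length_cons] at hle
  have := Nat.ble_eq.mp hk
  omega

/-- Whether the vector with code `c` is nonzero. -/
def nonzero (n c : ℕ) : Bool := !(Nat.beq (c % 2 ^ n) 0)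

lemma vec_ne_zero {n c : ℕ} (h : nonzero n c = true) : vec n c ≠ 0 := by
  intro h0
  rw [nonzero, mod_two_pow_eq_zero fun k hk => congrFun h0 ⟨k, hk⟩] at h
  exact Bool.false_ne_true h

/-- Checks that the matrix coded by `m` is zero or has three independent rows. -/
def rankThreeLeaf (n : ℕ) (_F m : ℕ) : Bool :=
  Nat.beq (m % 2 ^ (n * n)) 0 || forceMap (row n m) (List.range n) fun rs =>
    rs.any fun u => nonzero n u && rs.any fun v => nonzero n v && nonzero n (Nat.xor u v) &&
      rs.any fun w => nonzero n w && nonzero n (Nat.xor u w) && nonzero n (Nat.xor v w) &&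
        nonzero n (Nat.xor (Nat.xor u v) w)

/-- If rows `i`, `j`, `k` are independent, no nonzero combination of the corresponding basis vectors
is in the kernel. Independence is tested as nonvanishing of the seven nonzero combinations. -/
lemma not_hasRankTwo_of_checkAll (h : checkAll n (rankThreeLeaf n) l = true) :
    ¬ HasRankTwo (cubicForm l) := by
  rintro ⟨a, ha, H⟩
  obtain ⟨m, hm, hq⟩ := exists_codes_of_checkAll h a
  rw [rankThreeLeaf, Bool.or_eq_true, forceMap_eq] at hq
  rcases hq with hq | hq
  · exact ha (hm.mod_eq_zero_iff.mp (Nat.eq_of_beq_eq_true hq))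
  simp only [List.any_eq_true, Bool.and_eq_true, List.mem_map, List.mem_range] at hq
  obtain ⟨_, ⟨i, hi, rfl⟩, hu, _, ⟨j, hj, rfl⟩, ⟨hv, huv⟩, _, ⟨k, hk, rfl⟩, ⟨⟨hw, huw⟩, hvw⟩,
    huvw⟩ := hq
  obtain ⟨s, hs, hmem⟩ := H (Pi.single ⟨i, hi⟩ 1) (Pi.single ⟨j, hj⟩ 1) (Pi.single ⟨k, hk⟩ 1)
  rw [mem_rad_cubicForm] at hmem
  have hlin : s 0 • vec n (row n m i) + s 1 • vec n (row n m j) + s 2 • vec n (row n m k) = 0 := by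
    ext p
    have hp := hmem p
    have hsm : ∀ (r : ZMod 2) (b : Fin n → ZMod 2) c, tri l a (r • b) c = r * tri l a b c :=
      fun r b c => by rw [tri_swap_left, tri_smul_left, tri_swap_left]
    rw [tri_add_mid, tri_add_mid, hsm, hsm, hsm, ← hm.bitv_row, ← hm.bitv_row,
      ← hm.bitv_row] at hp
    exact hp
  have h01 : ∀ r : ZMod 2, r = 0 ∨ r = 1 := by decide
  have hu := vec_ne_zero hu
  have hv := vec_ne_zero hv
  have hw := vec_ne_zero hw
  have huv := vec_ne_zero huv
  have huw := vec_ne_zero huw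
  have hvw := vec_ne_zero hvw
  have huvw := vec_ne_zero huvw
  simp only [vec_xor] at huv huw hvw huvw
  rcases h01 (s 0) with h0 | h0 <;> rcases h01 (s 1) with h1 | h1 <;>
    rcases h01 (s 2) with h2 | h2 <;>
    simp only [h0, h1, h2, zero_smul, one_smul, zero_add, add_zero] at hlin
  · refine hs (funext fun t => ?_)
    fin_cases t
    exacts [h0, h1, h2]
  all_goals contradiction

/-- Checks that the matrix of the vector with code `c` is the alternating matrix of rank two
defined by `p` and `q`. -/
def rankTwoCheck (n c p q : ℕ) (l : List (Fin n × Fin n × Fin n)) : Bool :=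
  forceMap (word n l) (List.range n) fun ws => force (combine ws c) fun m =>
    !(Nat.beq (m % 2 ^ (n * n)) 0) && (List.range n).all fun j =>
      Nat.beq (row n m j) (Nat.xor (cond (tb p j) q 0) (cond (tb q j) p 0))

/-- The form is `⟨b, p⟩⟨c, q⟩ + ⟨b, q⟩⟨c, p⟩`, so its kernel contains everything orthogonal to `p`
and `q`; any three vectors are dependent modulo two linear conditions. -/
lemma hasRankTwo_of_rankTwoCheck (c p q : ℕ) (h : rankTwoCheck n c p q l = true) :
    HasRankTwo (cubicForm l) := by
  rw [rankTwoCheck, forceMap_eq, force_eq, Bool.and_eq_true, List.all_eq_true] at h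
  have hm := codes_combine l c
  rw [words] at hm
  obtain ⟨h0, h⟩ := h
  refine ⟨vec n c, fun hr => ?_, fun c₁ c₂ c₃ => ?_⟩
  · rw [hm.mod_eq_zero_iff.mpr hr] at h0
    exact Bool.false_ne_true h0
  have hcond : ∀ (b : Bool) (r k : ℕ), bitv (cond b r 0) k = bz b * bitv r k := fun b r k => by
    cases b <;> simp [bz, bitv_zero]
  have htri : ∀ b k, tri l (vec n c) b (Pi.single k 1) =
      (b ⬝ᵥ vec n p) * vec n q k + (b ⬝ᵥ vec n q) * vec n p k := fun b k => by
    rw [tri_eq_sum_mid, dotProduct, dotProduct, Finset.sum_mul, Finset.sum_mul,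
      ← Finset.sum_add_distrib]
    refine Finset.sum_congr rfl fun j _ => ?_
    rw [← hm.bitv_row, Nat.eq_of_beq_eq_true (h j (List.mem_range.mpr j.isLt)), bitv_xor, hcond,
      hcond, tb_eq, tb_eq]
    simp only [vec, bitv]
    ring
  have hdep : ∀ x₁ x₂ x₃ y₁ y₂ y₃ : ZMod 2, ∃ s : Fin 3 → ZMod 2, s ≠ 0 ∧
      s 0 * x₁ + s 1 * x₂ + s 2 * x₃ = 0 ∧ s 0 * y₁ + s 1 * y₂ + s 2 * y₃ = 0 := by decide
  obtain ⟨s, hs, hx, hy⟩ := hdep (c₁ ⬝ᵥ vec n p) (c₂ ⬝ᵥ vec n p) (c₃ ⬝ᵥ vec n p)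
    (c₁ ⬝ᵥ vec n q) (c₂ ⬝ᵥ vec n q) (c₃ ⬝ᵥ vec n q)
  refine ⟨s, hs, (mem_rad_cubicForm _ _ _).mpr fun k => ?_⟩
  simp only [htri, add_dotProduct, smul_dotProduct, smul_eq_mul, hx, hy, zero_mul, add_zero]

lemma Codes.mem_rad_of_combine {l : List (Fin n × Fin n × Fin n)} {a : Fin n → ZMod 2} {m : ℕ}
    (h : Codes l a m) (s : ℕ) :
    combine ((List.range n).map (row n m)) s % 2 ^ n = 0 ↔ vec n s ∈ rad (cubicForm l) a := by
  have key : ∀ k : Fin n, bitv (combine ((List.range n).map (row n m)) s) k =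
      tri l a (vec n s) (Pi.single k 1) := fun k => by
    rw [bitv_combine_map, tri_eq_sum_mid]
    exact Finset.sum_congr rfl fun j _ => by rw [h.bitv_row]
  rw [mem_rad_cubicForm]
  constructor
  · intro h0 k
    rw [← key, bitv_eq_zero_of_mod h0 k.isLt]
  · exact fun H => mod_two_pow_eq_zero fun k hk => (key ⟨k, hk⟩).trans (H _)

lemma Codes.add {l : List (Fin n × Fin n × Fin n)} {a b : Fin n → ZMod 2} {m m' : ℕ}
    (h : Codes l a m) (h' : Codes l b m') : Codes l (a + b) (Nat.xor m m') where
  pair j k := by rw [bitv_xor, h.pair, h'.pair, tri_add_left]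
  index := by rw [shiftRight_xor, vec_xor, h.index, h'.index]

/-- Checks, for the matrix `m₀`, that a matrix `m` whose kernel contains `S` is `0` or `m₀`. -/
def rigidLeaf (n : ℕ) (S : List ℕ) (m₀ m : ℕ) : Bool :=
  (forceMap (row n m) (List.range n) fun rs => S.any fun s => nonzero n (combine rs s)) ||
    Nat.beq (m % 2 ^ (n * n)) 0 || Nat.beq (Nat.xor m₀ m % 2 ^ (n * n)) 0

/-- Checks that the kernel of the matrix of the vector with code `c` contains `S`, and that only
`0` and this matrix have this property. -/
def rigidCheck (n c : ℕ) (S : List ℕ) (l : List (Fin n × Fin n × Fin n)) : Bool :=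
  forceMap (word n l) (List.range n) fun ws => force (combine ws c) fun m =>
    !(Nat.beq (m % 2 ^ (n * n)) 0) &&
    (forceMap (row n m) (List.range n) fun rs => S.all fun s => !(nonzero n (combine rs s))) &&
    allTree (rigidLeaf n S m) ws 0

/-- If `rad f a ⊆ rad f b`, the matrix of `b` kills `S`. The search over all `b` leaves only the
zero matrix and that of `a`, and equal matrices mean that `a + b` is in the radical. `S` may be any
part of the kernel that is large enough for the search to succeed. -/
lemma hasRigidRad_of_rigidCheck (c : ℕ) (S : List ℕ) (h : rigidCheck n c S l = true) :
    HasRigidRad (cubicForm l) := by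
  rw [rigidCheck, forceMap_eq, force_eq, forceMap_eq, Bool.and_eq_true, Bool.and_eq_true,
    List.all_eq_true] at h
  obtain ⟨⟨h0, hS⟩, h⟩ := h
  have hm := codes_combine l c
  rw [words] at hm
  refine ⟨vec n c, fun hr => ?_, fun b hb => ?_⟩
  · rw [hm.mod_eq_zero_iff.mpr hr] at h0
    exact Bool.false_ne_true h0
  obtain ⟨m', hm', hq⟩ := exists_codes_of_allTree h b
  rw [rigidLeaf, forceMap_eq, Bool.or_eq_true, Bool.or_eq_true, List.any_eq_true] at hq
  rcases hq with (⟨s, hs, hq⟩ | hq) | hq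
  · exfalso
    have h1 := hS s hs
    simp only [nonzero, Bool.not_not] at h1
    have h2 := (hm'.mem_rad_of_combine s).mpr
      (hb ((hm.mem_rad_of_combine s).mp (Nat.eq_of_beq_eq_true h1)))
    rw [nonzero, h2] at hq
    exact Bool.false_ne_true hq
  · exact Or.inl (hm'.mod_eq_zero_iff.mp (Nat.eq_of_beq_eq_true hq))
  · exact Or.inr ((hm.add hm').mod_eq_zero_iff.mp (Nat.eq_of_beq_eq_true hq))

/-- Checks that the linear map `ω` with matrix `om` satisfies `tri l (ω a) b c = tri l a b (ω c)`
and that `ω² + ω + 1` maps to the radical. -/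
def centroidCheck (n : ℕ) (om : List ℕ) (l : List (Fin n × Fin n × Fin n)) : Bool :=
  forceMap (word n l) (List.range n) fun ws => Nat.beq om.length n &&
    (forceMap (combine ws) om fun W => (List.range n).all fun i => (List.range n).all fun j =>
      (List.range n).all fun k =>
        tb (W.getD i 0) (n * j + k) == tb (W.getD k 0) (n * i + j)) &&
    (List.range n).all fun i => Nat.beq (combine ws (Nat.xor (Nat.xor (combine om (om.getD i 0))
      (om.getD i 0)) (2 ^ i)) % 2 ^ (n * n)) 0

/-- Modulo the radical, `ω` is multiplication by a generator of the field with 4 elements, and it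
moves freely between the arguments of the form. Hence `rad f a ⊆ rad f (ω a)` for every `a`.
Rigidity would put `ω a` or `a + ω a` in the radical, and then `ω² + ω + 1 = 0` forces `a` into it
as well. -/
lemma not_hasRigidRad_of_centroidCheck (om : List ℕ) (h : centroidCheck n om l = true) :
    ¬ HasRigidRad (cubicForm l) := by
  rw [centroidCheck, forceMap_eq, forceMap_eq] at h
  simp only [Bool.and_eq_true, List.all_eq_true, List.mem_range, beq_iff_eq] at h
  obtain ⟨⟨hlen, hsymm⟩, hquad⟩ := h
  have hlen := Nat.eq_of_beq_eq_true hlen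
  let ω : (Fin n → ZMod 2) → (Fin n → ZMod 2) := fun x => ∑ i, x i • vec n (om.getD i 0)
  have hω : ∀ c, ω (vec n c) = vec n (combine om c) := fun c => (vec_combine hlen c).symm
  -- By symmetry of the form, the right side is the value with `ω` applied to the third argument, so
  -- this is self-adjointness on basis vectors.
  have hbasis : ∀ i j k : Fin n, tri l (vec n (om.getD i 0)) (Pi.single j 1) (Pi.single k 1) =
      tri l (vec n (om.getD k 0)) (Pi.single i 1) (Pi.single j 1) := fun i j k => by
    have h1 := hsymm i i.isLt j j.isLt k k.isLt
    have h2 : ∀ i : Fin n, (om.map (combine ((List.range n).map (word n l)))).getD i 0 =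
        combine (words n l) (om.getD i 0) := fun i => by
      have hi : (i : ℕ) < om.length := by rw [hlen]; exact i.isLt
      rw [List.getD_eq_getElem _ _ (by simpa using hi), List.getD_eq_getElem _ _ hi,
        List.getElem_map]
      rfl
    rw [h2, h2, tb_eq, tb_eq] at h1
    rw [← (codes_combine l _).pair, ← (codes_combine l _).pair]
    exact congrArg bz h1
  have hcen : ∀ a b c, tri l (ω a) b c = tri l a b (ω c) := fun a b c => by
    have e1 : tri l (ω a) b c = ∑ i, ∑ j, ∑ k, a i * (b j * (c k *
        tri l (vec n (om.getD i 0)) (Pi.single j 1) (Pi.single k 1))) := by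
      rw [tri_sum_smul_left]
      refine Finset.sum_congr rfl fun i _ => ?_
      rw [tri_eq_sum_mid, Finset.mul_sum]
      refine Finset.sum_congr rfl fun j _ => ?_
      rw [tri_eq_sum_right, Finset.mul_sum, Finset.mul_sum]
    have e2 : tri l a b (ω c) = ∑ k, ∑ i, ∑ j, c k * (a i * (b j *
        tri l (vec n (om.getD k 0)) (Pi.single i 1) (Pi.single j 1))) := by
      rw [tri_swap_right, tri_swap_left, tri_sum_smul_left]
      refine Finset.sum_congr rfl fun k _ => ?_
      rw [tri_eq_sum_mid, Finset.mul_sum]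
      refine Finset.sum_congr rfl fun i _ => ?_
      rw [tri_eq_sum_right, Finset.mul_sum, Finset.mul_sum]
    rw [e1, e2]
    conv_rhs => rw [Finset.sum_comm]
    refine Finset.sum_congr rfl fun i _ => ?_
    conv_rhs => rw [Finset.sum_comm]
    refine Finset.sum_congr rfl fun j _ => Finset.sum_congr rfl fun k _ => ?_
    rw [hbasis]
    ring
  have hquad' : ∀ a b c, tri l (ω (ω a)) b c + tri l (ω a) b c + tri l a b c = 0 := fun a b c => by
    have hi : ∀ i : Fin n, tri l (ω (vec n (om.getD i 0))) b c + tri l (vec n (om.getD i 0)) b c +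
        tri l (Pi.single i 1) b c = 0 := fun i => by
      have h1 := (codes_combine l _).mod_eq_zero_iff.mp
        (Nat.eq_of_beq_eq_true (hquad i i.isLt)) b
      have h2 := tri_eq_zero_of_mem_rad h1 c
      rwa [vec_xor, vec_xor, tri_add_left, tri_add_left, vec_two_pow, ← hω] at h2
    -- Self-adjointness moves the outer `ω` to the last argument, so expanding `ω a` is enough.
    have hωs : tri l (ω (ω a)) b c = ∑ i, a i * tri l (ω (vec n (om.getD i 0))) b c := by
      rw [hcen, tri_sum_smul_left]
      exact Finset.sum_congr rfl fun i _ => by rw [hcen]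
    rw [hωs, tri_sum_smul_left, tri_eq_sum_left l a, ← Finset.sum_add_distrib,
      ← Finset.sum_add_distrib]
    refine Finset.sum_eq_zero fun i _ => ?_
    rw [← mul_add, ← mul_add, hi, mul_zero]
  rintro ⟨a, ha, H⟩
  apply ha
  have hin : ∀ a, InRadical (cubicForm l) a ↔ ∀ b c, tri l a b c = 0 := fun a =>
    ⟨fun h b c => tri_eq_zero_of_mem_rad (h b) c, fun h b => (mem_rad_cubicForm _ _ _).mpr
      fun k => h _ _⟩
  rw [hin]
  intro b c
  have hsub : rad (cubicForm l) a ⊆ rad (cubicForm l) (ω a) := fun b hb =>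
    (mem_rad_cubicForm _ _ _).mpr fun k => by rw [hcen, tri_eq_zero_of_mem_rad hb]
  have hq := hquad' a b c
  rcases H _ hsub with h1 | h1
  · rw [hin] at h1
    rwa [hcen, h1, h1, zero_add, zero_add] at hq
  · rw [hin] at h1
    simp only [tri_add_left] at h1
    -- Taking `ω c` as last argument gives `tri (ω a) b c + tri (ω (ω a)) b c = 0`; subtracting this
    -- from the quadratic relation leaves `tri a b c = 0`.
    have h2 := h1 b (ω c)
    rw [← hcen, ← hcen] at h2
    linear_combination hq - h2

end Checks

/-! ### The listed functions -/

set_option maxRecDepth 100000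

/-- Here and below, bit `i` of a code is the coordinate `x_i`. The first list spans the isotropic
subspace, the second consists of unit vectors spanning a complement, and the third expresses the
standard basis in the combined basis. -/
lemma h10_1_mem_completedMM : h10_1 ∈ completedMM 5 :=
  mem_completedMM_of_mmCheck [259, 676, 424, 816, 960] [1, 2, 4, 8, 16]
    [32, 64, 128, 256, 512, 910, 893, 747, 97, 487] _ (by decide +kernel)

lemma h10_2_mem_completedMM : h10_2 ∈ completedMM 5 :=
  mem_completedMM_of_mmCheck [3, 12, 272, 96, 640] [1, 4, 16, 32, 128]
    [32, 33, 64, 66, 128, 256, 264, 512, 132, 528] _ (by decide +kernel)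

/-- Ten exempted directions are fewer than the `2 ^ 5` that membership requires. -/
lemma h10_3_notMem_completedMM : h10_3 ∉ completedMM 5 :=
  not_mem_completedMM_of_checkAll _ [0, 59, 240, 351, 356, 664, 675, 780, 967, 1020]
    (by decide) (by decide +kernel)

/-- Zero must be exempted, being isotropic to everything; every other direction fails the local
test. -/
lemma h10_4_notMem_completedMM : h10_4 ∉ completedMM 5 :=
  not_mem_completedMM_of_checkAll _ [0] (by decide) (by decide +kernel)

lemma h12_1_mem_completedMM : h12_1 ∈ completedMM 6 :=
  mem_completedMM_of_mmCheck [3489, 1666, 2980, 1800, 1584, 3648] [1, 2, 4, 8, 16, 64]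
    [64, 128, 256, 512, 1024, 1365, 2048, 455, 845, 4030, 3835, 2405] _ (by decide +kernel)

lemma h12_2_mem_completedMM : h12_2 ∈ completedMM 6 :=
  mem_completedMM_of_mmCheck [3489, 1666, 2980, 1800, 1584, 3648] [1, 2, 4, 8, 16, 64]
    [64, 128, 256, 512, 1024, 1365, 2048, 455, 845, 4030, 3835, 2405] _ (by decide +kernel)

lemma h12_3_mem_completedMM : h12_3 ∈ completedMM 6 :=
  mem_completedMM_of_mmCheck [1985, 3970, 2244, 2376, 2640, 3168] [1, 2, 4, 8, 16, 32]
    [64, 128, 256, 512, 1024, 2048, 3965, 455, 715, 1235, 2275, 4030] _ (by decide +kernel)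

lemma h12_4_mem_completedMM : h12_4 ∈ completedMM 6 :=
  mem_completedMM_of_mmCheck [3969, 1986, 2244, 2376, 2640, 3168] [1, 2, 4, 8, 16, 32]
    [64, 128, 256, 512, 1024, 2048, 4030, 455, 715, 1235, 2275, 3965] _ (by decide +kernel)

lemma h12_5_mem_completedMM : h12_5 ∈ completedMM 6 :=
  mem_completedMM_of_mmCheck [3, 132, 264, 528, 1056, 2112] [1, 4, 8, 16, 32, 64]
    [64, 65, 128, 256, 512, 1024, 2048, 130, 260, 520, 1040, 2080] _ (by decide +kernel)

/-! ### Bentness outside `ℳ^#` and values of the invariants -/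

lemma isBent_h10_3 : IsBent h10_3 := isBent_of_checkAll _ (by decide +kernel)

lemma isBent_h10_4 : IsBent h10_4 := isBent_of_checkAll _ (by decide +kernel)

lemma hasSmallRad_h10_1 : HasSmallRad 4 h10_1 :=
  hasSmallRad_of_smallRadCheck _ 2 3 (by decide +kernel)

lemma not_hasSmallRad_h10_2 : ¬ HasSmallRad 4 h10_2 :=
  not_hasSmallRad_of_checkAll _ 4 (by decide +kernel)

lemma radicalCardGE_h10_3 : RadicalCardGE 2 h10_3 :=
  radicalCardGE_of_radicalCheck _ [0, 1020] (by decide) (by decide +kernel)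

lemma not_radicalCardGE_h10_4 : ¬ RadicalCardGE 2 h10_4 :=
  not_radicalCardGE_of_checkAll _ [0] (by decide) (by decide +kernel)

lemma radicalCardGE_h12_1 : RadicalCardGE 4 h12_1 :=
  radicalCardGE_of_radicalCheck _ [0, 1366, 2729, 4095] (by decide) (by decide +kernel)

lemma radicalCardGE_h12_2 : RadicalCardGE 4 h12_2 :=
  radicalCardGE_of_radicalCheck _ [0, 1366, 2729, 4095] (by decide) (by decide +kernel)

lemma radicalCardGE_h12_3 : RadicalCardGE 2 h12_3 :=
  radicalCardGE_of_radicalCheck _ [0, 4095] (by decide) (by decide +kernel)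

lemma not_radicalCardGE_h12_3 : ¬ RadicalCardGE 4 h12_3 :=
  not_radicalCardGE_of_checkAll _ [0, 4095] (by decide) (by decide +kernel)

lemma radicalCardGE_h12_4 : RadicalCardGE 4 h12_4 :=
  radicalCardGE_of_radicalCheck _ [0, 1365, 2730, 4095] (by decide) (by decide +kernel)

lemma not_radicalCardGE_h12_5 : ¬ RadicalCardGE 2 h12_5 :=
  not_radicalCardGE_of_checkAll _ [0] (by decide) (by decide +kernel)

lemma not_hasRankTwo_h12_1 : ¬ HasRankTwo h12_1 :=
  not_hasRankTwo_of_checkAll _ (by decide +kernel)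

lemma hasRankTwo_h12_4 : HasRankTwo h12_4 :=
  hasRankTwo_of_rankTwoCheck _ 125 660 3435 (by decide +kernel)

lemma hasRigidRad_h12_1 : HasRigidRad h12_1 :=
  hasRigidRad_of_rigidCheck _ 6 [513, 3586, 3588, 2696, 1040, 544, 3648, 3840]
    (by decide +kernel)

lemma not_hasRigidRad_h12_2 : ¬ HasRigidRad h12_2 :=
  not_hasRigidRad_of_centroidCheck _
    [2, 4092, 3232, 2380, 652, 1336, 2608, 1252, 2248, 916, 808, 3664] (by decide +kernel)

lemma hasRigidRad_h12_4 : HasRigidRad h12_4 :=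
  -- This is the direction with the rank-two matrix of `hasRankTwo_h12_4`. The supports of 660 and
  -- 3435 partition the coordinates, and the ten sums of two unit vectors within one support form a
  -- basis of the kernel.
  hasRigidRad_of_rigidCheck _ 125 [2049, 2050, 516, 2056, 528, 2080, 2112, 640, 2304, 3072]
    (by decide +kernel)

/-! ### Bentness and counting of classes -/

lemma isHomogeneousCubicBent_of_mem_known10 {h : BoolFun 10} (hh : h ∈ known10) :
    IsHomogeneousCubicBent h := by
  rcases hh with rfl | rfl | rfl | rfl
  · exact isHomogeneousCubicBent_cubicForm (by decide) _ (by decide +kernel)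
      (isBent_of_mem_completedMM h10_1_mem_completedMM)
  · exact isHomogeneousCubicBent_cubicForm (by decide) _ (by decide +kernel)
      (isBent_of_mem_completedMM h10_2_mem_completedMM)
  · exact isHomogeneousCubicBent_cubicForm (by decide) _ (by decide +kernel) isBent_h10_3
  · exact isHomogeneousCubicBent_cubicForm (by decide) _ (by decide +kernel) isBent_h10_4

lemma mem_completedMM_of_mem_known12 {h : BoolFun 12} (hh : h ∈ known12) : h ∈ completedMM 6 := by
  rcases hh with rfl | rfl | rfl | rfl | rfl
  exacts [h12_1_mem_completedMM, h12_2_mem_completedMM, h12_3_mem_completedMM,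
    h12_4_mem_completedMM, h12_5_mem_completedMM]

lemma isHomogeneousCubicBent_of_mem_known12 {h : BoolFun 12} (hh : h ∈ known12) :
    IsHomogeneousCubicBent h := by
  have hb : IsBent h := isBent_of_mem_completedMM (mem_completedMM_of_mem_known12 hh)
  rcases hh with rfl | rfl | rfl | rfl | rfl <;>
    exact isHomogeneousCubicBent_cubicForm (by decide) _ (by decide +kernel) hb

lemma RadicalCardGE.mono {n k k' : ℕ} {f : BoolFun n} (hk : k' ≤ k) (h : RadicalCardGE k f) :
    RadicalCardGE k' f :=
  hk.trans h

lemma ncard_equivClass_known10 : (equivClass '' known10).ncard = 4 := by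
  have hmm : ∀ {f g : BoolFun 10}, f ∈ completedMM 5 → g ∉ completedMM 5 →
      equivClass f ≠ equivClass g := fun hf hg h =>
    hg (equivClass_subset_completedMM hf (equivalent_of_equivClass_eq h))
  have h12 : equivClass h10_1 ≠ equivClass h10_2 := fun h =>
    not_hasSmallRad_h10_2 ((equivalent_of_equivClass_eq h).hasSmallRad hasSmallRad_h10_1)
  have h34 : equivClass h10_3 ≠ equivClass h10_4 := fun h =>
    not_radicalCardGE_h10_4
      ((equivalent_of_equivClass_eq h).symm.radicalCardGE radicalCardGE_h10_3)
  have h13 := hmm h10_1_mem_completedMM h10_3_notMem_completedMM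
  have h14 := hmm h10_1_mem_completedMM h10_4_notMem_completedMM
  have h23 := hmm h10_2_mem_completedMM h10_3_notMem_completedMM
  have h24 := hmm h10_2_mem_completedMM h10_4_notMem_completedMM
  simp only [known10, Set.image_insert_eq, Set.image_singleton]
  rw [Set.ncard_insert_of_notMem (by simp [h12, h13, h14]),
    Set.ncard_insert_of_notMem (by simp [h23, h24]), Set.ncard_pair h34]

lemma ncard_equivClass_known12 : (equivClass '' known12).ncard = 5 := by
  have hrad : ∀ k {f g : BoolFun 12}, RadicalCardGE k f → ¬ RadicalCardGE k g →
      equivClass f ≠ equivClass g := fun _ _ _ hf hg h =>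
    hg ((equivalent_of_equivClass_eq h).symm.radicalCardGE hf)
  have h13 := hrad 4 radicalCardGE_h12_1 not_radicalCardGE_h12_3
  have h23 := hrad 4 radicalCardGE_h12_2 not_radicalCardGE_h12_3
  have h43 := hrad 4 radicalCardGE_h12_4 not_radicalCardGE_h12_3
  have h15 := hrad 2 (radicalCardGE_h12_1.mono (by decide)) not_radicalCardGE_h12_5
  have h25 := hrad 2 (radicalCardGE_h12_2.mono (by decide)) not_radicalCardGE_h12_5
  have h35 := hrad 2 radicalCardGE_h12_3 not_radicalCardGE_h12_5
  have h45 := hrad 2 (radicalCardGE_h12_4.mono (by decide)) not_radicalCardGE_h12_5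
  have h14 : equivClass h12_1 ≠ equivClass h12_4 := fun h =>
    not_hasRankTwo_h12_1 ((equivalent_of_equivClass_eq h).hasRankTwo hasRankTwo_h12_4)
  have h12 : equivClass h12_1 ≠ equivClass h12_2 := fun h =>
    not_hasRigidRad_h12_2 ((equivalent_of_equivClass_eq h).symm.hasRigidRad hasRigidRad_h12_1)
  have h24 : equivClass h12_2 ≠ equivClass h12_4 := fun h =>
    not_hasRigidRad_h12_2 ((equivalent_of_equivClass_eq h).hasRigidRad hasRigidRad_h12_4)
  simp only [known12, Set.image_insert_eq, Set.image_singleton]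
  rw [Set.ncard_insert_of_notMem (by simp [h12, h13, h14, h15]),
    Set.ncard_insert_of_notMem (by simp [h23, h24, h25]),
    Set.ncard_insert_of_notMem (by simp [h43.symm, h35]), Set.ncard_pair h45]

end CubicBent

theorem mainTheorem3 :
    ((∀ h ∈ CubicBent.known10, CubicBent.IsHomogeneousCubicBent h) ∧
      (CubicBent.equivClass '' CubicBent.known10).ncard = 4 ∧
      CubicBent.equivClass CubicBent.h10_1 ⊆ CubicBent.completedMM 5 ∧
      CubicBent.equivClass CubicBent.h10_2 ⊆ CubicBent.completedMM 5 ∧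
      Disjoint (CubicBent.equivClass CubicBent.h10_3) (CubicBent.completedMM 5) ∧
      Disjoint (CubicBent.equivClass CubicBent.h10_4) (CubicBent.completedMM 5)) ∧
    ((∀ h ∈ CubicBent.known12, CubicBent.IsHomogeneousCubicBent h) ∧
      (CubicBent.equivClass '' CubicBent.known12).ncard = 5 ∧
      ∀ h ∈ CubicBent.known12, CubicBent.equivClass h ⊆ CubicBent.completedMM 6) :=
  ⟨⟨fun _ => CubicBent.isHomogeneousCubicBent_of_mem_known10,
    CubicBent.ncard_equivClass_known10,
    CubicBent.equivClass_subset_completedMM CubicBent.h10_1_mem_completedMM,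
    CubicBent.equivClass_subset_completedMM CubicBent.h10_2_mem_completedMM,
    CubicBent.disjoint_equivClass_completedMM CubicBent.h10_3_notMem_completedMM,
    CubicBent.disjoint_equivClass_completedMM CubicBent.h10_4_notMem_completedMM⟩,
   ⟨fun _ => CubicBent.isHomogeneousCubicBent_of_mem_known12,
    CubicBent.ncard_equivClass_known12,
    fun _ h => CubicBent.equivClass_subset_completedMM
      (CubicBent.mem_completedMM_of_mem_known12 h)⟩⟩
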